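/- Let $L$ be a first-order language and let $T$ be a complete $L$-theory with infinite models that is o-minimal, i.e. $T$ is the theory of an $L$-structure $N$ with a dense linear order, definable without parameters (for instance by a symbol of $L$), such that every subset of $N$ definable with parameters is a finite union of points and open intervals with endpoints in $N\cup\{\pm\infty\}$. Let $T_P$ be the theory of lovely pairs of models of $T$: the theory in the language $L_P=L\cup\{P\}$, $P$ a new unary predicate, whose models are the pairs $(M,P)$ with $M\models T$ and $P\subseteq M$ such that, for all $n,m,k\in\mathbb{N}$, all $L$-formulas $\varphi(\bar x,x)$, $\psi(\bar x,\bar y,x)$ with $|\bar x|=n$, $|\bar y|=m$, and all $\bar a\in M^n$: 1. if $\bar a\in P^n$ and $M\models\exists x\,\varphi(\bar a,x)$, then $M\models\varphi(\bar a,c)$ for some $c\in P$ (so $P$ is an elementary substructure of $M$); 2. if $\varphi(\bar a,x)$ has infinitely many solutions in $M$, then it has a solution in $P$; 3. if $\varphi(\bar a,x)$ has infinitely many solutions in $M$ and for every $\bar b\in M^m$ the formula $\psi(\bar a,\bar b,x)$ has fewer than $k$ solutions in $M$, then there is $c\in M$ with $M\models\varphi(\bar a,c)$ and $M\models\neg\psi(\bar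 a,\bar b,c)$ for all $\bar b\in P^m$. Let $(\mathfrak{C},P)$ be a monster model of $T_P$, i.e. a saturated model of $T_P$ whose cardinality is larger than $|L|+\aleph_0$ (for example a strongly inaccessible cardinal). Suppose that in $\mathfrak{C}$ $$\operatorname{dcl}(A)=\bigcup_{a\in A}\operatorname{dcl}(a)\qquad\text{for every non-empty } A\subseteq\mathfrak{C},$$ where $\operatorname{dcl}(A)$ is the set of all $a\in\mathfrak{C}$ such that $\{a\}$ is definable in the $L$-structure $\mathfrak{C}$ with parameters from $A$. Then $o(P)=e(P)$, where $$o(P)=\{\sigma(P)\mid \sigma\in\operatorname{Aut}_L(\mathfrak{C})\},\qquad e(P)=\{P'\subseteq\mathfrak{C}\mid(\mathfrak{C},P')\equiv_{L_P}(\mathfrak{C},P)\}.$$ -/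

import Mathlib

open FirstOrder Cardinal

universe u v w w'

namespace LovelyPairs

/-! ### o-minimal structures -/

/-- Open intervals with endpoints in `N ∪ {-∞, +∞}`. -/
inductive IsOpenInterval {N : Type w} [LinearOrder N] : Set N → Prop
  | Ioo (a b : N) : IsOpenInterval (Set.Ioo a b)
  | Iio (b : N) : IsOpenInterval (Set.Iio b)
  | Ioi (a : N) : IsOpenInterval (Set.Ioi a)
  | univ : IsOpenInterval Set.univ

/-- The `L`-structure `N` is o-minimal with respect to its linear order: the order belongs to the
structure (it is definable without parameters, for instance by a symbol of `L`), and every subset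
of `N` that is definable with parameters is a finite union of points and open intervals with
endpoints in `N ∪ {-∞, +∞}`. -/
structure IsOMinimal (L : FirstOrder.Language.{u, v}) (N : Type w) [L.Structure N]
    [LinearOrder N] : Prop where
  definable_lt : (∅ : Set N).Definable₂ L {p | p.1 < p.2}
  finite_union : ∀ s : Set N, (Set.univ : Set N).Definable₁ L s →
    ∃ S : Set (Set N), S.Finite ∧ (∀ I ∈ S, (∃ a, I = {a}) ∨ IsOpenInterval I) ∧ s = ⋃₀ S

/-! ### Definable closure and saturation -/

/-- The definable closure of `A` in `M`: the elements `a` such that `{a}` is definable over `A`. -/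
def dcl (L : FirstOrder.Language.{u, v}) {M : Type w} [L.Structure M] (A : Set M) : Set M :=
  {a | A.Definable₁ L {a}}

/-- `M` is saturated: for every `A ⊆ M` with `|A| < |M|`, every 1-type over `A` (a set of formulas
in one variable with parameters in `A` that is finitely satisfiable in `M`) is realized in `M`. -/
def IsSaturated (L : FirstOrder.Language.{u, v}) (M : Type w) [L.Structure M] : Prop :=
  ∀ A : Set M, #A < #M → ∀ p : Set (L[[A]].Formula Unit),
    (∀ q : Finset (L[[A]].Formula Unit), (q : Set (L[[A]].Formula Unit)) ⊆ p →
      ∃ x : M, ∀ φ ∈ q, φ.Realize (fun _ => x)) →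
    ∃ x : M, ∀ φ ∈ p, φ.Realize (fun _ => x)

/-! ### Expansions by a unary predicate -/

/-- The symbols of the language with one relation symbol, which is unary. -/
inductive PredSymbol : ℕ → Type
  | P : PredSymbol 1

/-- The language with one unary relation symbol and nothing else. -/
def predLanguage : FirstOrder.Language.{0, 0} := ⟨fun _ => Empty, PredSymbol⟩

/-- The language `L ∪ {P}`, for a new unary relation symbol `P`. -/
abbrev pairLanguage (L : FirstOrder.Language.{u, v}) : FirstOrder.Language.{u, v} :=
  L.sum predLanguage

/-- The universe of the expansion `(M, P)` of `M` by `P ⊆ M`; a copy of `M`. -/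
def Pair {M : Type w} (_P : Set M) : Type w := M

instance structurePair {L : FirstOrder.Language.{u, v}} {M : Type w} [inst : L.Structure M]
    (P : Set M) : L.Structure (Pair P) := inst

/-- In `(M, P)` the new predicate is interpreted by `P`. The interpretation of `L ∪ {P}` is then
obtained through `FirstOrder.Language.sumStructure`. -/
instance predStructurePair {M : Type w} (P : Set M) : predLanguage.Structure (Pair P) where
  funMap := fun f => nomatch f
  RelMap := fun r => match r with
    | PredSymbol.P => fun x => (x 0 : M) ∈ P

/-- `o(P)`: the images of `P` under the automorphisms of the `L`-structure `M`. -/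
def orbit (L : FirstOrder.Language.{u, v}) {M : Type w} [L.Structure M] (P : Set M) :
    Set (Set M) :=
  {P' | ∃ σ : M ≃[L] M, σ '' P = P'}

/-- `e(P)`: the subsets `P'` of `M` such that `(M, P')` and `(M, P)` satisfy the same sentences
of `L ∪ {P}`. -/
def elementaryClass (L : FirstOrder.Language.{u, v}) {M : Type w} [L.Structure M] (P : Set M) :
    Set (Set M) :=
  {P' | (pairLanguage L).ElementarilyEquivalent (Pair P) (Pair P')}

/-! ### The theory of lovely pairs -/

/-- `(M, P)` is a model of the theory `T_P` of lovely pairs of models of `T`: `M` is a model of `T`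
and `(M, P)` satisfies the three axiom schemes of `T_P`. The quantifier "there are infinitely many"
has its literal meaning and "there are less than `k`" is expressed through `Set.encard`. -/
structure IsModelOfLovelyPairTheory {L : FirstOrder.Language.{u, v}} (T : L.Theory) {M : Type w}
    [L.Structure M] (P : Set M) : Prop where
  model : M ⊨ T
  /-- `P` is the universe of an elementary substructure of `M`. -/
  elementary : ∀ (n : ℕ) (φ : L.Formula (Fin n ⊕ Unit)) (a : Fin n → M), (∀ i, a i ∈ P) →
    (∃ x : M, φ.Realize (Sum.elim a fun _ => x)) →
    ∃ x ∈ P, φ.Realize (Sum.elim a fun _ => x)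
  density : ∀ (n : ℕ) (φ : L.Formula (Fin n ⊕ Unit)) (a : Fin n → M),
    {x : M | φ.Realize (Sum.elim a fun _ => x)}.Infinite →
    ∃ x ∈ P, φ.Realize (Sum.elim a fun _ => x)
  extension : ∀ (n m k : ℕ) (φ : L.Formula (Fin n ⊕ Unit))
    (ψ : L.Formula ((Fin n ⊕ Fin m) ⊕ Unit)) (a : Fin n → M),
    (∀ b : Fin m → M,
      {x : M | ψ.Realize (Sum.elim (Sum.elim a b) fun _ => x)}.encard < k) →
    {x : M | φ.Realize (Sum.elim a fun _ => x)}.Infinite →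
    ∃ x : M, φ.Realize (Sum.elim a fun _ => x) ∧
      ∀ b : Fin m → M, (∀ i, b i ∈ P) → ¬ ψ.Realize (Sum.elim (Sum.elim a b) fun _ => x)

/-- `(M, P)` is a monster model of the theory of lovely pairs of models of `T`: a saturated model of
that theory whose cardinality is uncountable and larger than the number of symbols of `L`. -/
structure IsMonsterLovelyPair {L : FirstOrder.Language.{u, v}} (T : L.Theory) {M : Type w}
    [L.Structure M] (P : Set M) : Prop where
  isModel : IsModelOfLovelyPairTheory T P
  isSaturated : IsSaturated (pairLanguage L) (Pair P)
  aleph0_lt : ℵ₀ < #M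
  card_lt : Cardinal.lift.{w} L.card < Cardinal.lift.{max u v} #M

end LovelyPairs

/-! An automorphism of the `L`-structure is an isomorphism of pairs, so one inclusion is formal. For
the other, an automorphism carrying `P` to a given `P'` in `e(P)` is built by transfinite
back-and-forth. Only `L`-types have to be realized, and saturation of `(M, P)` suffices for that;
`(M, P')` need not be saturated. What is used of `P'` is elementary (`IsTamePredicate`): it is dense
and codense, and contains the definable closure of the empty set and of each of its points.

Let a partial elementary relation respect the two predicates, let `a` be a new point and let `b`
realize the transported type of `a`. If `a` is in the definable closure of the domain, degeneracy
puts it in the closure of a single point `a₀`; by `exchange`, membership of `a` in the predicate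
then depends only on that of `a₀` and on whether `a` is in `dcl ∅`, so it is preserved (`mem_iff`).
Otherwise a whole interval to the left of `b` realizes the type, and by density and codensity it has
a point on the right side of `P'`.

Both cases rest on `exists_left`: an `A`-definable set containing some `b` outside `dcl A` contains
an interval to the left of `b`. This follows from finiteness of the set of left ends
(`finite_leftEnds`). In `N` that is o-minimality; only the existence of successors among left ends
is transferred to `M`, and finiteness is recovered there from the pair: an infinite set of left ends
would have an infinite definable subset inside `P`, which the extension axiom forbids. -/

namespace LovelyPairs

open FirstOrder.Language Set

/-! ### Closure of definable sets under logical operations -/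

section Calculus

variable {L : FirstOrder.Language.{u, v}} {M : Type w} [L.Structure M] {A : Set M} {α : Type*}

theorem definable_and {p q : (α → M) → Prop} (hp : A.Definable L {v | p v})
    (hq : A.Definable L {v | q v}) : A.Definable L {v | p v ∧ q v} := hp.inter hq

theorem definable_or {p q : (α → M) → Prop} (hp : A.Definable L {v | p v})
    (hq : A.Definable L {v | q v}) : A.Definable L {v | p v ∨ q v} := hp.union hq

theorem definable_not {p : (α → M) → Prop} (hp : A.Definable L {v | p v}) :
    A.Definable L {v | ¬ p v} := hp.compl

theorem definable_imp {p q : (α → M) → Prop} (hp : A.Definable L {v | p v})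
    (hq : A.Definable L {v | q v}) : A.Definable L {v | p v → q v} := by
  simpa only [imp_iff_not_or] using definable_or (definable_not hp) hq

theorem definable_all {p : (α → M) → M → Prop}
    (hp : A.Definable L {v : α ⊕ Unit → M | p (fun i => v (.inl i)) (v (.inr ()))}) :
    A.Definable L {v | ∀ x, p v x} := by
  obtain ⟨φ, hφ⟩ := hp
  refine ⟨φ.iAlls Unit, ?_⟩
  ext v
  have h := fun x : Unit → M => Set.ext_iff.1 hφ (Sum.elim v x)
  simp only [mem_ofPred_eq, Sum.elim_inl, Sum.elim_inr] at h
  change _ ↔ (φ.iAlls Unit).Realize v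
  rw [Formula.realize_iAlls]
  exact ⟨fun H x => (h x).1 (H _), fun H x => (h fun _ => x).2 (H _)⟩

theorem definable_ex {p : (α → M) → M → Prop}
    (hp : A.Definable L {v : α ⊕ Unit → M | p (fun i => v (.inl i)) (v (.inr ()))}) :
    A.Definable L {v | ∃ x, p v x} := by
  simpa only [not_forall, not_not] using definable_not (definable_all (p := fun v x => ¬ p v x) (definable_not hp))

theorem definable_mem {X : Set M} (hX : A.Definable₁ L X) (i : α) :
    A.Definable L {v : α → M | v i ∈ X} := hX.preimage_comp fun _ => i

theorem definable_rel {G : M → M → Prop} (hG : A.Definable₂ L {p | G p.1 p.2}) (i j : α) :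
    A.Definable L {v : α → M | G (v i) (v j)} := by
  simpa using Set.Definable.preimage_comp ![i, j] hG

theorem definable_eq (i j : α) : A.Definable L {v : α → M | v i = v j} :=
  ⟨Term.equal (Term.var i) (Term.var j), by ext v; simp⟩

theorem definable₁_iff {X : Set M} : A.Definable₁ L X ↔
    ∃ (n : ℕ) (φ : L.Formula (Fin n ⊕ Unit)) (a : Fin n → M), (∀ i, a i ∈ A) ∧
      X = {x | φ.Realize (Sum.elim a fun _ => x)} := by
  constructor
  · intro h
    obtain ⟨A₀, hA₀, h⟩ := definable_iff_finitely_definable.1 h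
    obtain ⟨φ, hφ⟩ := definable_iff_exists_formula_sum.1 h
    let e := A₀.equivFin
    refine ⟨A₀.card, φ.relabel (Sum.map e fun _ => ()), fun i => e.symm i,
      fun i => hA₀ (e.symm i).2, ?_⟩
    ext x
    have := Set.ext_iff.1 hφ fun _ => x
    refine this.trans ?_
    simp only [mem_ofPred_eq, Formula.realize_relabel]
    refine iff_of_eq (congrArg _ (funext fun i => ?_))
    rcases i with i | i <;> simp
  · rintro ⟨n, φ, a, ha, rfl⟩
    refine definable_iff_exists_formula_sum.2
      ⟨φ.relabel (Sum.map (fun i => ⟨a i, ha i⟩) fun _ => 0), ?_⟩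
    ext x
    change φ.Realize _ ↔ (φ.relabel _).Realize _
    rw [Formula.realize_relabel]
    refine iff_of_eq (congrArg _ (funext fun i => ?_))
    rcases i with i | i <;> simp

end Calculus

/-! ### Transfer of first-order properties between elementarily equivalent structures -/

section Transfer

/-- The predicates `p` on `N` and `q` on `M` are defined by the same `L`-formula. -/
def Codefinable (L : FirstOrder.Language.{u, v}) {N : Type w'} {M : Type w} [L.Structure N]
    [L.Structure M] {α : Type*} (p : (α → N) → Prop) (q : (α → M) → Prop) : Prop :=
  ∃ φ : L.Formula α, (∀ v, p v ↔ φ.Realize v) ∧ ∀ v, q v ↔ φ.Realize v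

variable {L : FirstOrder.Language.{u, v}} {N : Type w'} {M : Type w} [L.Structure N]
    [L.Structure M] {α : Type*}

namespace Codefinable

variable {p p' : (α → N) → Prop} {q q' : (α → M) → Prop}

theorem not (h : Codefinable L p q) : Codefinable L (fun v => ¬ p v) (fun v => ¬ q v) := by
  obtain ⟨φ, h₁, h₂⟩ := h
  exact ⟨φ.not, by simp [h₁], by simp [h₂]⟩

theorem imp (h : Codefinable L p q) (h' : Codefinable L p' q') :
    Codefinable L (fun v => p v → p' v) (fun v => q v → q' v) := by
  obtain ⟨φ, h₁, h₂⟩ := h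
  obtain ⟨ψ, h₃, h₄⟩ := h'
  exact ⟨φ.imp ψ, by simp [h₁, h₃], by simp [h₂, h₄]⟩

theorem and (h : Codefinable L p q) (h' : Codefinable L p' q') :
    Codefinable L (fun v => p v ∧ p' v) (fun v => q v ∧ q' v) := by
  obtain ⟨φ, h₁, h₂⟩ := h
  obtain ⟨ψ, h₃, h₄⟩ := h'
  exact ⟨φ ⊓ ψ, by simp [h₁, h₃], by simp [h₂, h₄]⟩

theorem or (h : Codefinable L p q) (h' : Codefinable L p' q') :
    Codefinable L (fun v => p v ∨ p' v) (fun v => q v ∨ q' v) := by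
  obtain ⟨φ, h₁, h₂⟩ := h
  obtain ⟨ψ, h₃, h₄⟩ := h'
  exact ⟨φ ⊔ ψ, by simp [h₁, h₃], by simp [h₂, h₄]⟩

theorem alls {β : Type*} [Finite β] {p : (α → N) → (β → N) → Prop} {q : (α → M) → (β → M) → Prop}
    (h : Codefinable L (fun v : α ⊕ β → N => p (fun i => v (.inl i)) (fun i => v (.inr i)))
      (fun v : α ⊕ β → M => q (fun i => v (.inl i)) (fun i => v (.inr i)))) :
    Codefinable L (fun v => ∀ x, p v x) (fun v => ∀ x, q v x) := by
  obtain ⟨φ, h₁, h₂⟩ := h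
  refine ⟨φ.iAlls β, fun v => ?_, fun v => ?_⟩ <;> rw [Formula.realize_iAlls]
  · exact forall_congr' fun x => h₁ (Sum.elim v x)
  · exact forall_congr' fun x => h₂ (Sum.elim v x)

theorem all {p : (α → N) → N → Prop} {q : (α → M) → M → Prop}
    (h : Codefinable L (fun v : α ⊕ Unit → N => p (fun i => v (.inl i)) (v (.inr ())))
      (fun v : α ⊕ Unit → M => q (fun i => v (.inl i)) (v (.inr ())))) :
    Codefinable L (fun v => ∀ x, p v x) (fun v => ∀ x, q v x) := by
  obtain ⟨φ, h₁, h₂⟩ := alls (p := fun v x => p v (x ())) (q := fun v x => q v (x ())) h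
  exact ⟨φ, fun v => ⟨fun H => (h₁ v).1 fun x => H _, fun H x => (h₁ v).2 H fun _ => x⟩,
    fun v => ⟨fun H => (h₂ v).1 fun x => H _, fun H x => (h₂ v).2 H fun _ => x⟩⟩

theorem ex {p : (α → N) → N → Prop} {q : (α → M) → M → Prop}
    (h : Codefinable L (fun v : α ⊕ Unit → N => p (fun i => v (.inl i)) (v (.inr ())))
      (fun v : α ⊕ Unit → M => q (fun i => v (.inl i)) (v (.inr ())))) :
    Codefinable L (fun v => ∃ x, p v x) (fun v => ∃ x, q v x) := by
  simpa only [not_forall, not_not] using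
    not (all (p := fun v x => ¬ p v x) (q := fun v x => ¬ q v x) (not h))

theorem eq (i j : α) :
    Codefinable L (fun v : α → N => v i = v j) (fun v : α → M => v i = v j) :=
  ⟨Term.equal (Term.var i) (Term.var j), by simp, by simp⟩

theorem realize {β : Type*} (φ : L.Formula β) (f : β → α) :
    Codefinable L (fun v : α → N => φ.Realize fun i => v (f i))
      (fun v : α → M => φ.Realize fun i => v (f i)) :=
  ⟨φ.relabel f, fun v => by rw [Formula.realize_relabel]; rfl,
    fun v => by rw [Formula.realize_relabel]; rfl⟩

theorem realize_elim {n : ℕ} (φ : L.Formula (Fin n ⊕ Unit)) (f : Fin n → α) (i : α) :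
    Codefinable L (fun v : α → N => φ.Realize (Sum.elim (fun j => v (f j)) fun _ => v i))
      (fun v : α → M => φ.Realize (Sum.elim (fun j => v (f j)) fun _ => v i)) := by
  have h : ∀ v : α → N,
      (Sum.elim (fun j => v (f j)) fun _ : Unit => v i) = fun j => v (Sum.elim f (fun _ => i) j) :=
    fun v => funext fun j => by cases j <;> rfl
  have h' : ∀ v : α → M,
      (Sum.elim (fun j => v (f j)) fun _ : Unit => v i) = fun j => v (Sum.elim f (fun _ => i) j) :=
    fun v => funext fun j => by cases j <;> rfl
  simp only [h, h']
  exact realize φ _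

theorem transfer {p : (Empty → N) → Prop} {q : (Empty → M) → Prop} (h : Codefinable L p q)
    (hNM : N ≅[L] M) (hp : ∀ v, p v) (v : Empty → M) : q v := by
  obtain ⟨φ, h₁, h₂⟩ := h
  rw [h₂, Subsingleton.elim v default]
  exact (elementarilyEquivalent_iff.1 hNM φ).1 ((h₁ default).1 (hp _))

end Codefinable

end Transfer

/-! ### Saturation in terms of definable sets -/

section Saturation

variable {L : FirstOrder.Language.{u, v}} {M : Type w} [L.Structure M]

/-- In a saturated structure a downward directed family of nonempty sets definable over a small set
has nonempty intersection. -/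
theorem IsSaturated.exists_forall_mem (hM : IsSaturated L M) {A : Set M} (hA : #A < #M)
    {F : Set (Set M)} (hne : F.Nonempty) (hF : ∀ S ∈ F, A.Definable₁ L S)
    (hdir : ∀ S ∈ F, ∀ T ∈ F, ∃ U ∈ F, U ⊆ S ∩ T) (hnonempty : ∀ S ∈ F, S.Nonempty) :
    ∃ x, ∀ S ∈ F, x ∈ S := by
  obtain ⟨x, hx⟩ := hM A hA {φ | ∃ S ∈ F, ∀ x, φ.Realize (fun _ => x) ↔ x ∈ S} (by
    intro q hq
    suffices h : ∃ S ∈ F, ∀ x ∈ S, ∀ φ ∈ q, φ.Realize (fun _ => x) by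
      obtain ⟨S, hS, h⟩ := h
      obtain ⟨x, hx⟩ := hnonempty S hS
      exact ⟨x, h x hx⟩
    classical
    induction q using Finset.induction_on with
    | empty =>
      obtain ⟨S, hS⟩ := hne
      exact ⟨S, hS, by simp⟩
    | insert φ q _ ih =>
      rw [Finset.coe_insert, insert_subset_iff] at hq
      obtain ⟨T, hT, h⟩ := ih hq.2
      obtain ⟨S, hS, h'⟩ := hq.1
      obtain ⟨U, hU, hUST⟩ := hdir S hS T hT
      refine ⟨U, hU, fun x hx ψ hψ => ?_⟩
      rcases Finset.mem_insert.1 hψ with rfl | hψ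
      · exact (h' x).2 (hUST hx).1
      · exact h x (hUST hx).2 ψ hψ)
  refine ⟨x, fun S hS => ?_⟩
  obtain ⟨φ, hφ⟩ := hF S hS
  have key : ∀ x, (φ.relabel fun _ => ()).Realize (fun _ : Unit => x) ↔ x ∈ S := fun x => by
    rw [Formula.realize_relabel]
    exact (Set.ext_iff.1 hφ fun _ => x).symm
  exact (key x).1 (hx _ ⟨S, hS, key⟩)

end Saturation

/-! ### First-order consequences of o-minimality -/

section TameOrder

/-- The elements of `X` at which `X` contains no interval to the left. -/
def leftEnds {M : Type w} [LT M] (X : Set M) : Set M :=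
  {x | x ∈ X ∧ ¬ ∃ u, u < x ∧ ∀ z, u < z → z < x → z ∈ X}

/-- First-order consequences of o-minimality: definable sets have suprema, and in the set of left
ends of a definable set every element except the last has a successor. -/
structure TameOrder (L : FirstOrder.Language.{u, v}) (M : Type w) [L.Structure M]
    [LinearOrder M] : Prop where
  definable_lt : (∅ : Set M).Definable₂ L {p | p.1 < p.2}
  leftEnds_succ : ∀ X : Set M, (univ : Set M).Definable₁ L X → ∀ x ∈ leftEnds X,
    (∀ z ∈ leftEnds X, ¬ x < z) ∨ ∃ s ∈ leftEnds X, x < s ∧ ∀ z ∈ leftEnds X, x < z → ¬ z < s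
  exists_sup : ∀ X : Set M, (univ : Set M).Definable₁ L X → (∃ x, x ∈ X) →
    (∃ b, ∀ x ∈ X, ¬ b < x) → ∃ b, (∀ x ∈ X, ¬ b < x) ∧ ∀ z, z < b → ∃ x ∈ X, z < x

theorem IsOpenInterval.exists_left {N : Type w} [LinearOrder N] {I : Set N}
    (hI : IsOpenInterval I) {x : N} (hx : x ∈ I) (hmin : ∃ y, y < x) :
    ∃ u, u < x ∧ ∀ z, u < z → z < x → z ∈ I := by
  obtain ⟨y, hy⟩ := hmin
  cases hI with
  | Ioo a b => exact ⟨a, hx.1, fun z h h' => ⟨h, h'.trans hx.2⟩⟩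
  | Iio b => exact ⟨y, hy, fun z _ h' => h'.trans hx⟩
  | Ioi a => exact ⟨a, hx, fun z h _ => h⟩
  | univ => exact ⟨y, hy, fun _ _ _ => trivial⟩

theorem IsOpenInterval.exists_isLUB {N : Type w} [LinearOrder N] [DenselyOrdered N] {I : Set N}
    (hI : IsOpenInterval I) (hne : I.Nonempty) (hb : BddAbove I) : ∃ b, IsLUB I b := by
  obtain ⟨x, hx⟩ := hne
  have lub : ∀ b, (∀ z ∈ I, z < b) → (∀ z, x < z → z < b → z ∈ I) → IsLUB I b := by
    refine fun b h₁ h₂ => ⟨fun z hz => (h₁ z hz).le, fun c hc => le_of_not_gt fun hcb => ?_⟩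
    obtain ⟨d, hd, hd'⟩ := exists_between (max_lt hcb (h₁ x hx))
    exact absurd (hc (h₂ d ((le_max_right _ _).trans_lt hd) hd'))
      (not_le.2 ((le_max_left _ _).trans_lt hd))
  -- If everything to the right of `x` lies in `I`, then any upper bound of `I` is already the least
  -- one.
  have top : (∀ z, x < z → z ∈ I) → ∃ b, IsLUB I b := by
    obtain ⟨c, hc⟩ := hb
    refine fun h => ⟨c, hc, fun d hd => le_of_not_gt fun hdc => ?_⟩
    exact absurd (hd (h c ((hd hx).trans_lt hdc))) (not_le.2 hdc)
  cases hI with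
  | Ioo a b => exact ⟨b, lub b (fun z hz => hz.2) fun z h h' => ⟨hx.1.trans h, h'⟩⟩
  | Iio b => exact ⟨b, lub b (fun z hz => hz) fun z _ h' => h'⟩
  | Ioi a => exact top fun z h => lt_trans hx h
  | univ => exact top fun z _ => trivial

theorem exists_isLUB_sUnion {N : Type w} [LinearOrder N] {S : Set (Set N)} (hS : S.Finite)
    (h : ∀ I ∈ S, I.Nonempty → BddAbove I → ∃ b, IsLUB I b) (hne : (⋃₀ S).Nonempty)
    (hb : BddAbove (⋃₀ S)) : ∃ b, IsLUB (⋃₀ S) b := by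
  induction S, hS using Set.Finite.induction_on with
  | empty => simp at hne
  | @insert I S _ _ ih =>
    rw [sUnion_insert] at hne hb ⊢
    have ih' := fun h' => ih (fun J hJ => h J (mem_insert_of_mem _ hJ)) h'
      (hb.mono subset_union_right)
    have hI' := fun h' => h I (mem_insert _ _) h' (hb.mono subset_union_left)
    rcases I.eq_empty_or_nonempty with rfl | hI
    · simpa using ih' (by simpa using hne)
    · obtain ⟨b, hb⟩ := hI' hI
      rcases (⋃₀ S).eq_empty_or_nonempty with h0 | h0
      · rw [h0]
        exact ⟨b, by simpa using hb⟩
      · obtain ⟨c, hc⟩ := ih' h0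
        exact ⟨_, hb.union hc⟩

theorem IsOMinimal.tameOrder {L : FirstOrder.Language.{u, v}} {N : Type w} [L.Structure N]
    [LinearOrder N] [DenselyOrdered N] (hN : IsOMinimal L N) : TameOrder L N where
  definable_lt := hN.definable_lt
  leftEnds_succ := by
    intro X hX x hx
    obtain ⟨S, hS, hI, rfl⟩ := hN.finite_union X hX
    -- A left end is either one of the isolated points listed in `S`, or lies in an open interval of
    -- `S`; the latter is possible only for the minimum of `N`.
    have hfin : (leftEnds (⋃₀ S)).Finite := by
      have h₁ : {a : N | {a} ∈ S}.Finite :=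
        hS.preimage (f := fun a => ({a} : Set N)) singleton_injective.injOn
      have h₂ : {a : N | ∀ y, ¬ y < a}.Subsingleton := fun a ha b hb =>
        le_antisymm (not_lt.1 (ha b)) (not_lt.1 (hb a))
      refine (h₁.union h₂.finite).subset ?_
      rintro a ⟨⟨I, hIS, ha⟩, h⟩
      rcases hI I hIS with ⟨b, rfl⟩ | hI
      · rw [mem_singleton_iff] at ha
        exact Or.inl (by rwa [ha])
      · refine Or.inr fun y hy => h ?_
        obtain ⟨c, hc, h⟩ := hI.exists_left ha ⟨y, hy⟩
        exact ⟨c, hc, fun z hz hz' => ⟨I, hIS, h z hz hz'⟩⟩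
    by_cases hmax : ∀ z ∈ leftEnds (⋃₀ S), ¬ x < z
    · exact Or.inl hmax
    · push Not at hmax
      obtain ⟨z, hz, hxz⟩ := hmax
      obtain ⟨s, hs, hmin⟩ := exists_min_image _ id (hfin.inter_of_left (Ioi x)) ⟨z, hz, hxz⟩
      exact Or.inr ⟨s, hs.1, hs.2, fun z hz hxz => not_lt.2 (hmin z ⟨hz, hxz⟩)⟩
  exists_sup := by
    rintro X hX hne ⟨c, hc⟩
    obtain ⟨S, hS, hI, rfl⟩ := hN.finite_union X hX
    obtain ⟨b, hb⟩ := exists_isLUB_sUnion hS (fun I hIS hne hbdd => by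
      rcases hI I hIS with ⟨a, rfl⟩ | h
      · exact ⟨a, isLUB_singleton⟩
      · exact h.exists_isLUB hne hbdd) hne ⟨c, fun x hx => not_lt.1 (hc x hx)⟩
    exact ⟨b, fun x hx => not_lt.2 (hb.1 hx), fun z hz => (lt_isLUB_iff hb).1 hz⟩

theorem definable₂_iff {L : FirstOrder.Language.{u, v}} {M : Type w} [L.Structure M]
    {G : M → M → Prop} : (∅ : Set M).Definable₂ L {p | G p.1 p.2} ↔
      ∃ φ : L.Formula (Fin 2), ∀ v, φ.Realize v ↔ G (v 0) (v 1) := by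
  refine empty_definable_iff.trans (exists_congr fun φ => ?_)
  rw [Set.ext_iff]
  exact forall_congr' fun v => Iff.comm

/-- The formula that defines the order of `N` defines one on `M`. The fields of `TameOrder` are
stated with `<` and its negation only, so for a fixed formula defining `X` each becomes one
sentence, universally quantified over the parameters. -/
theorem TameOrder.transfer {L : FirstOrder.Language.{u, v}} {N : Type w'} [L.Structure N]
    [LinearOrder N] [DenselyOrdered N] (hN : TameOrder L N) {M : Type w} [L.Structure M]
    (hNM : N ≅[L] M) : ∃ _ : LinearOrder M, DenselyOrdered M ∧ TameOrder L M := by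
  obtain ⟨φ, hφ⟩ := definable₂_iff.1 hN.definable_lt
  let r : M → M → Prop := fun x y => φ.Realize ![x, y]
  have lt : ∀ {α : Type} (i j : α), Codefinable L (fun v : α → N => v i < v j)
      (fun v : α → M => r (v i) (v j)) := fun i j => by
    refine ⟨φ.relabel ![i, j], fun v => ?_, fun v => ?_⟩ <;> rw [Formula.realize_relabel]
    · simp [hφ]
    · change φ.Realize ![v i, v j] ↔ _
      refine iff_of_eq (congrArg _ (funext fun k => ?_))
      fin_cases k <;> rfl
  have irrefl : ∀ x, ¬ r x x := Codefinable.transfer (Codefinable.all (p := fun _ x => ¬ x < x)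
    (q := fun _ x => ¬ r x x) (lt _ _).not) hNM (fun _ => lt_irrefl) Empty.elim
  have trans : ∀ x y z, r x y → r y z → r x z :=
    Codefinable.transfer (Codefinable.all (p := fun _ x => ∀ y z, x < y → y < z → x < z)
      (q := fun _ x => ∀ y z, r x y → r y z → r x z) <| .all <| .all <|
        (lt _ _).imp <| (lt _ _).imp (lt _ _)) hNM
      (fun _ _ _ _ => lt_trans) Empty.elim
  have tri : ∀ x y, r x y ∨ x = y ∨ r y x :=
    Codefinable.transfer (Codefinable.all (p := fun _ x => ∀ y, x < y ∨ x = y ∨ y < x)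
      (q := fun _ x => ∀ y, r x y ∨ x = y ∨ r y x) <| .all <|
        (lt _ _).or <| (Codefinable.eq _ _).or (lt _ _)) hNM
      (fun _ => lt_trichotomy) Empty.elim
  have dense : ∀ x y, r x y → ∃ z, r x z ∧ r z y :=
    Codefinable.transfer (Codefinable.all (p := fun _ x => ∀ y, x < y → ∃ z, x < z ∧ z < y)
      (q := fun _ x => ∀ y, r x y → ∃ z, r x z ∧ r z y) <| .all <|
        (lt _ _).imp <| .ex <| (lt _ _).and (lt _ _)) hNM
      (fun _ _ _ => exists_between) Empty.elim
  have : IsStrictTotalOrder M r :=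
    { irrefl := irrefl
      trans := trans
      trichotomous := fun x y h h' => ((tri x y).resolve_left h).resolve_right h' }
  classical
  let _ : LinearOrder M := linearOrderOfSTO r
  refine ⟨inferInstance, ⟨fun x y h => dense x y h⟩, ?_, ?_, ?_⟩
  · refine definable₂_iff.2 ⟨φ, fun v => ?_⟩
    refine iff_of_eq (congrArg _ (funext fun k => ?_))
    fin_cases k <;> rfl
  · intro X hX
    obtain ⟨n, ψ, a, -, rfl⟩ := definable₁_iff.1 hX
    have ends : ∀ {α : Type} (f : Fin n → α) (i : α),
        Codefinable L
          (fun v : α → N => v i ∈ leftEnds {x | ψ.Realize (Sum.elim (fun j => v (f j)) fun _ => x)})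
          (fun v : α → M =>
            v i ∈ leftEnds {x | ψ.Realize (Sum.elim (fun j => v (f j)) fun _ => x)}) :=
      fun f i => (Codefinable.realize_elim ψ _ _).and <| .not <| .ex <| (lt _ _).and <| .all <|
        (lt _ _).imp <| (lt _ _).imp <| .realize_elim ψ _ _
    refine Codefinable.transfer (Codefinable.alls (β := Fin n)
      (p := fun _ a => ∀ x ∈ leftEnds {x | ψ.Realize (Sum.elim a fun _ => x)},
        (∀ z ∈ leftEnds {x | ψ.Realize (Sum.elim a fun _ => x)}, ¬ x < z) ∨
        ∃ s ∈ leftEnds {x | ψ.Realize (Sum.elim a fun _ => x)},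
          x < s ∧ ∀ z ∈ leftEnds {x | ψ.Realize (Sum.elim a fun _ => x)}, x < z → ¬ z < s)
      (q := fun _ a => ∀ x ∈ leftEnds {x | ψ.Realize (Sum.elim a fun _ => x)},
        (∀ z ∈ leftEnds {x | ψ.Realize (Sum.elim a fun _ => x)}, ¬ x < z) ∨
        ∃ s ∈ leftEnds {x | ψ.Realize (Sum.elim a fun _ => x)},
          x < s ∧ ∀ z ∈ leftEnds {x | ψ.Realize (Sum.elim a fun _ => x)}, x < z → ¬ z < s) <|
      .all <| (ends _ _).imp <| .or (.all <| (ends _ _).imp (lt _ _).not) <| .ex <|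
      (ends _ _).and <| (lt _ _).and <| .all <| (ends _ _).imp <| (lt _ _).imp (lt _ _).not)
      hNM (fun _ a => hN.leftEnds_succ _
        (definable₁_iff.2 ⟨n, ψ, a, fun _ => trivial, rfl⟩)) Empty.elim a
  · intro X hX
    obtain ⟨n, ψ, a, -, rfl⟩ := definable₁_iff.1 hX
    refine Codefinable.transfer (Codefinable.alls (β := Fin n)
      (p := fun _ a => (∃ x, ψ.Realize (Sum.elim a fun _ => x)) →
        (∃ b, ∀ x, ψ.Realize (Sum.elim a fun _ => x) → ¬ b < x) →
        ∃ b, (∀ x, ψ.Realize (Sum.elim a fun _ => x) → ¬ b < x) ∧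
          ∀ z, z < b → ∃ x, ψ.Realize (Sum.elim a fun _ => x) ∧ z < x)
      (q := fun _ a => (∃ x, ψ.Realize (Sum.elim a fun _ => x)) →
        (∃ b, ∀ x, ψ.Realize (Sum.elim a fun _ => x) → ¬ b < x) →
        ∃ b, (∀ x, ψ.Realize (Sum.elim a fun _ => x) → ¬ b < x) ∧
          ∀ z, z < b → ∃ x, ψ.Realize (Sum.elim a fun _ => x) ∧ z < x) <|
      (Codefinable.ex (.realize_elim ψ _ _)).imp <|
      (Codefinable.ex <| .all <| .imp (.realize_elim ψ _ _) (lt _ _).not).imp <|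
      .ex <| .and (.all <| .imp (.realize_elim ψ _ _) (lt _ _).not) <|
      .all <| (lt _ _).imp <| .ex <| .and (.realize_elim ψ _ _) (lt _ _))
      hNM (fun _ a => hN.exists_sup _
        (definable₁_iff.2 ⟨n, ψ, a, fun _ => trivial, rfl⟩)) Empty.elim a

end TameOrder

/-! ### Definable closure -/

section DefinableClosure

variable {L : FirstOrder.Language.{u, v}} {M : Type w} [L.Structure M]

theorem definable₁_of {A : Set M} {p : M → Prop}
    (h : A.Definable L {v : Fin 1 → M | p (v 0)}) : A.Definable₁ L {x | p x} := h

theorem dcl_mono {A B : Set M} (h : A ⊆ B) : dcl L A ⊆ dcl L B := fun _ ha => ha.mono h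

theorem subset_dcl (A : Set M) : A ⊆ dcl L A := fun _ ha =>
  Definable.singleton_of_mem (L := L) ha

theorem mem_dcl_of_unique {A : Set M} {p : M → Prop} (hp : A.Definable₁ L {x | p x}) {a : M}
    (ha : p a) (h : ∀ x, p x → x = a) : a ∈ dcl L A := by
  have : {a} = {x | p x} := by
    ext x
    exact ⟨fun h => by rwa [mem_singleton_iff.1 h], h x⟩
  rwa [dcl, mem_ofPred_eq, this]

theorem definable₁_of_finite {A F : Set M} (hF : F.Finite) (hFA : F ⊆ dcl L A) :
    A.Definable₁ L F := by
  induction F, hF using Set.Finite.induction_on with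
  | empty => exact definable_empty
  | @insert a F _ _ ih =>
    rw [insert_subset_iff] at hFA
    exact Definable.union hFA.1 (ih hFA.2)

/-- Distinct points of `dcl A` have distinct defining formulas, and there are fewer than `#M`
formulas over `A`. -/
theorem card_dcl_lt {A : Set M} (hA : #A < #M) (hM : ℵ₀ < #M)
    (hL : Cardinal.lift.{w} L.card < Cardinal.lift.{max u v} #M) : #(dcl L A) < #M := by
  have h₁ : Cardinal.lift.{max u v} #(dcl L A) ≤ #(Σ n, L[[A]].BoundedFormula (Fin 1) n) := by
    have : ∀ a : dcl L A, ∃ φ : L[[A]].Formula (Fin 1),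
        {x : Fin 1 → M | x 0 = a.1} = {x | φ.Realize x} := fun a => a.2
    choose φ hφ using this
    have hinj : Function.Injective fun a : dcl L A =>
        (⟨0, φ a⟩ : Σ n, L[[A]].BoundedFormula (Fin 1) n) := by
      intro a b hab
      have hab : φ a = φ b := by simpa using hab
      have := hφ b
      rw [← hab, ← hφ a] at this
      have h : a.1 = b.1 := by
        have := Set.ext_iff.1 this fun _ => a.1
        exact this.2 (by simp)
      exact Subtype.ext h
    have h := Cardinal.lift_mk_le_lift_mk_of_injective hinj
    rwa [Cardinal.lift_umax.{w, max u v}, Cardinal.lift_id'.{w, max u v w}] at h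
  have h₂ := BoundedFormula.card_le (L := L[[A]]) (α := Fin 1)
  refine Cardinal.lift_lt.{w, max u v}.1 (h₁.trans_lt (h₂.trans_lt (max_lt (by simpa using hM) ?_)))
  have hM' : ℵ₀ ≤ Cardinal.lift.{max u v} #M := by simpa using hM.le
  refine add_lt_of_lt hM' (lt_of_lt_of_le ?_ hM') ?_
  · simp
  · rw [card_withConstants]
    simpa using add_lt_of_lt hM' hL (by simpa using hA)

/-- The greatest element of a finite definable set is definable; remove it and induct on the size.
-/
theorem mem_dcl_of_finite [LinearOrder M] {A : Set M} (hlt : A.Definable₂ L {p | p.1 < p.2})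
    {X : Set M} (hX : A.Definable₁ L X) (hfin : X.Finite) {x : M} (hx : x ∈ X) : x ∈ dcl L A := by
  induction hn : X.ncard using Nat.strong_induction_on generalizing X with
  | h n ih =>
    obtain ⟨m, hmX, hm⟩ := exists_max_image X id hfin ⟨x, hx⟩
    have hm' : m ∈ dcl L A := by
      refine mem_dcl_of_unique (p := fun y => y ∈ X ∧ ∀ z, z ∈ X → ¬ y < z) (definable₁_of ?_)
        ⟨hmX, fun z hz => not_lt.2 (hm z hz)⟩
        fun y hy => le_antisymm (hm y hy.1) (not_lt.1 (hy.2 m hmX))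
      exact definable_and (definable_mem hX _) <| definable_all <|
        definable_imp (definable_mem hX _) (definable_not (definable_rel hlt _ _))
    by_cases hxm : x = m
    · rwa [hxm]
    · refine ih _ ?_ (X := X \ {m}) ?_ (hfin.subset sdiff_subset) ⟨hx, hxm⟩ rfl
      · rw [← hn]
        exact ncard_sdiff_singleton_lt_of_mem hmX hfin
      · exact Definable.sdiff hX hm'

/-- All parameters in a definition of `a` equal `a₀`, so they can be replaced by one variable.
Restricting to the arguments at which the solution is unique makes the relation functional. -/
theorem definable₂_graph {a₀ a : M} (h : a ∈ dcl L {a₀}) :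
    ∃ G : M → M → Prop, (∅ : Set M).Definable₂ L {p | G p.1 p.2} ∧
      (∀ x y z, G x y → G x z → y = z) ∧ G a₀ a := by
  obtain ⟨n, φ, b, hb, h⟩ := definable₁_iff.1 h
  obtain rfl : b = fun _ => a₀ := funext hb
  have key : ∀ x, φ.Realize (Sum.elim (fun _ => a₀) fun _ => x) ↔ x = a :=
    fun x => (Set.ext_iff.1 h x).symm
  let F : M → M → Prop := fun x y => φ.Realize (Sum.elim (fun _ => x) fun _ => y)
  have hF : (∅ : Set M).Definable₂ L {p | F p.1 p.2} := by
    refine definable₂_iff.2 ⟨φ.relabel (Sum.elim (fun _ => 0) fun _ => 1), fun v => ?_⟩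
    rw [Formula.realize_relabel]
    refine iff_of_eq (congrArg _ (funext fun i => ?_))
    cases i <;> rfl
  refine ⟨fun x y => F x y ∧ ∀ z, F x z → z = y, ?_,
    fun x y z h₁ h₂ => h₂.2 y h₁.1, (key a).2 rfl, fun z hz => (key z).1 hz⟩
  exact definable_and (definable_rel hF _ _)
    (definable_all (definable_imp (definable_rel hF _ _) (definable_eq _ _)))

end DefinableClosure

/-! ### Density, codensity and closure of the predicate of a lovely pair -/

section Pairs

variable {L : FirstOrder.Language.{u, v}} {T : L.Theory} {M : Type w} [L.Structure M] {P : Set M}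

/-- The first-order properties of the predicate of a lovely pair of dense linear orders that are
used for the construction of automorphisms. -/
structure IsTamePredicate (L : FirstOrder.Language.{u, v}) {M : Type w} [L.Structure M]
    [LinearOrder M] (P : Set M) : Prop where
  exists_mem : ∀ x y, x < y → ∃ z, x < z ∧ z < y ∧ z ∈ P
  exists_notMem : ∀ x y, x < y → ∃ z, x < z ∧ z < y ∧ z ∉ P
  dcl_empty_subset : dcl L (∅ : Set M) ⊆ P
  dcl_singleton_subset : ∀ p ∈ P, dcl L {p} ⊆ P

theorem IsModelOfLovelyPairTheory.exists_mem (hP : IsModelOfLovelyPairTheory T P) {X : Set M}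
    (hX : (univ : Set M).Definable₁ L X) (hinf : X.Infinite) : ∃ x ∈ X, x ∈ P := by
  obtain ⟨n, φ, a, -, rfl⟩ := definable₁_iff.1 hX
  obtain ⟨x, hx, h⟩ := hP.density n φ a hinf
  exact ⟨x, h, hx⟩

theorem IsModelOfLovelyPairTheory.exists_notMem (hP : IsModelOfLovelyPairTheory T P) {X : Set M}
    (hX : (univ : Set M).Definable₁ L X) (hinf : X.Infinite) : ∃ x ∈ X, x ∉ P := by
  obtain ⟨n, φ, a, -, rfl⟩ := definable₁_iff.1 hX
  have key : ∀ (b : Fin 1 → M) (x : M), (Term.equal (Term.var (.inr ()))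
      (Term.var (.inl (.inr 0))) : L.Formula ((Fin n ⊕ Fin 1) ⊕ Unit)).Realize
      (Sum.elim (Sum.elim a b) fun _ => x) ↔ x = b 0 := by simp
  -- The formula `x = b` has one solution for each `b`, hence fewer than `k = 2`; avoiding all its
  -- solutions with `b` in `P` means avoiding `P`.
  obtain ⟨x, hx, h⟩ := hP.extension n 1 2 φ
    (Term.equal (Term.var (.inr ())) (Term.var (.inl (.inr 0)))) a (fun b => by
      simp only [key, ofPred_eq_eq_singleton, encard_singleton]
      norm_num) hinf
  exact ⟨x, hx, fun hxP => h (fun _ => x) (fun _ => hxP) ((key _ _).2 rfl)⟩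

theorem IsModelOfLovelyPairTheory.dcl_subset (hP : IsModelOfLovelyPairTheory T P) {A : Set M}
    (hA : A ⊆ P) : dcl L A ⊆ P := by
  intro a ha
  obtain ⟨n, φ, b, hb, h⟩ := definable₁_iff.1 ha
  have key : ∀ x, φ.Realize (Sum.elim b fun _ => x) ↔ x = a := fun x => (Set.ext_iff.1 h x).symm
  obtain ⟨x, hx, hφ⟩ := hP.elementary n φ b (fun i => hA (hb i)) ⟨a, (key a).2 rfl⟩
  rwa [← (key x).1 hφ]

theorem definable₁_pair {A X : Set M} (h : A.Definable₁ L X) :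
    Set.Definable₁ (M := Pair P) A (pairLanguage L) X :=
  have h : Set.Definable₁ (M := Pair P) A L X := h
  h.map_expansion LHom.sumInl

theorem definable₁_pred (A : Set M) :
    Set.Definable₁ (M := Pair P) A (pairLanguage L) P := by
  refine Set.Definable.mono (A := (∅ : Set (Pair P))) ?_ (empty_subset _)
  refine empty_definable_iff.2 ⟨Relations.formula₁ (L := pairLanguage L) (.inr PredSymbol.P)
    (Term.var 0), ?_⟩
  ext x
  change x 0 ∈ P ↔ _
  exact (Formula.realize_rel₁ (L := pairLanguage L) (M := Pair P) (R := .inr PredSymbol.P)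
    (t := Term.var 0) (v := x)).symm


theorem definable₂_pair {A : Set M} {X : Set (M × M)} (h : A.Definable₂ L X) :
    Set.Definable₂ (M := Pair P) A (pairLanguage L) X :=
  have h : Set.Definable₂ (M := Pair P) A L X := h
  h.map_expansion LHom.sumInl

theorem IsMonsterLovelyPair.exists_forall_mem (hP : IsMonsterLovelyPair T P) {A : Set M}
    (hA : #A < #M) {F : Set (Set M)} (hne : F.Nonempty)
    (hF : ∀ S ∈ F, Set.Definable₁ (M := Pair P) A (pairLanguage L) S)
    (hdir : ∀ S ∈ F, ∀ T ∈ F, ∃ U ∈ F, U ⊆ S ∩ T) (hnonempty : ∀ S ∈ F, S.Nonempty) :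
    ∃ x, ∀ S ∈ F, x ∈ S :=
  IsSaturated.exists_forall_mem (M := Pair P) hP.isSaturated hA hne hF hdir hnonempty

end Pairs

/-! ### Finiteness of left ends, and exchange -/

section Order

variable {L : FirstOrder.Language.{u, v}} {T : L.Theory} {M : Type w} [L.Structure M]
  [LinearOrder M] {P : Set M}

theorem TameOrder.definable₂_lt (hM : TameOrder L M) (A : Set M) :
    A.Definable₂ L {p | p.1 < p.2} := hM.definable_lt.mono (empty_subset A)

theorem TameOrder.definable_left (hM : TameOrder L M) {A X : Set M} {α : Type*}
    (hX : A.Definable₁ L X) (i : α) :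
    A.Definable L {v : α → M | ∃ u, u < v i ∧ ∀ z, u < z → z < v i → z ∈ X} :=
  definable_ex <| definable_and (definable_rel (hM.definable₂_lt A) _ _) <| definable_all <|
    definable_imp (definable_rel (hM.definable₂_lt A) _ _) <|
    definable_imp (definable_rel (hM.definable₂_lt A) _ _) (definable_mem hX _)

theorem TameOrder.definable₁_leftEnds (hM : TameOrder L M) {A X : Set M}
    (hX : A.Definable₁ L X) : A.Definable₁ L (leftEnds X) :=
  definable₁_of <| definable_and (definable_mem hX _) (definable_not (hM.definable_left hX _))

theorem TameOrder.definable₁_Ioi (hM : TameOrder L M) {A : Set M} {a : M} (ha : a ∈ A) :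
    A.Definable₁ L (Ioi a) := by
  have h : Ioi a = {x | ∃ y, y ∈ ({a} : Set M) ∧ y < x} := by ext; simp
  rw [h]
  exact definable₁_of <| definable_ex <| definable_and (definable_mem (subset_dcl A ha) _)
    (definable_rel (hM.definable₂_lt A) _ _)

theorem TameOrder.definable₁_Iio (hM : TameOrder L M) {A : Set M} {a : M} (ha : a ∈ A) :
    A.Definable₁ L (Iio a) := by
  have h : Iio a = {x | ∃ y, y ∈ ({a} : Set M) ∧ x < y} := by ext; simp
  rw [h]
  exact definable₁_of <| definable_ex <| definable_and (definable_mem (subset_dcl A ha) _)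
    (definable_rel (hM.definable₂_lt A) _ _)

theorem TameOrder.definable₁_Ici (hM : TameOrder L M) {A : Set M} {a : M} (ha : a ∈ A) :
    A.Definable₁ L (Ici a) := by
  rw [← compl_Iio]
  exact Definable.compl (hM.definable₁_Iio ha)

theorem TameOrder.definable₁_Iic (hM : TameOrder L M) {A : Set M} {a : M} (ha : a ∈ A) :
    A.Definable₁ L (Iic a) := by
  rw [← compl_Ioi]
  exact Definable.compl (hM.definable₁_Ioi ha)

/-- Were the set `D` of left ends infinite, `P` would contain a point of `D` outside `dcl A`. By
degeneracy its successors in `D` remain in `P`, and saturation yields an infinite definable piece of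
`D` contained in `P`, against codensity. -/
theorem IsMonsterLovelyPair.finite_leftEnds (hP : IsMonsterLovelyPair T P) (hM : TameOrder L M)
    (hdcl : ∀ A : Set M, A.Nonempty → dcl L A = ⋃ a ∈ A, dcl L {a}) {X : Set M}
    (hX : (univ : Set M).Definable₁ L X) : (leftEnds X).Finite := by
  by_contra hinf
  obtain ⟨A, -, hA⟩ := definable_iff_finitely_definable.1 hX
  set D := leftEnds X
  have hlt := hM.definable₂_lt
  have hDA : (A : Set M).Definable₁ L D := hM.definable₁_leftEnds hA
  have hAcard : #(A : Set M) < #M := (Cardinal.lt_aleph0_of_finite _).trans hP.aleph0_lt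
  -- A point `c` outside `dcl A` is not the last element of `D`. Its successor `s` is outside `dcl
  -- A` too, as `c` is the predecessor of `s`; since `s` is in `dcl (A ∪ {c})`, degeneracy leaves
  -- only `s ∈ dcl {c}`, which is inside `P`.
  have step : ∀ c : M, c ∈ D ∧ c ∈ P ∧ c ∉ dcl L (A : Set M) →
      ∃ s, (s ∈ D ∧ s ∈ P ∧ s ∉ dcl L (A : Set M)) ∧ c < s ∧ ∀ z ∈ D, c < z → ¬ z < s := by
    rintro c ⟨hcD, hcP, hc⟩
    rcases hM.leftEnds_succ X hX c hcD with h | ⟨s, hs, hcs, hmin⟩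
    · refine absurd (mem_dcl_of_unique (p := fun y => y ∈ D ∧ ∀ z, z ∈ D → ¬ y < z)
        (definable₁_of ?_) ⟨hcD, h⟩ fun x hx => ?_) hc
      · exact definable_and (definable_mem hDA _) <| definable_all <|
          definable_imp (definable_mem hDA _) (definable_not (definable_rel (hlt _) _ _))
      · exact le_antisymm (not_lt.1 (h x hx.1)) (not_lt.1 (hx.2 c hcD))
    · have hsA : s ∉ dcl L (A : Set M) := by
        intro hsA
        refine hc (mem_dcl_of_unique (p := fun x => x ∈ D ∧ ∃ y, y ∈ ({s} : Set M) ∧ x < y ∧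
          ∀ z, z ∈ D → x < z → ¬ z < y) (definable₁_of ?_) ⟨hcD, s, rfl, hcs, hmin⟩ ?_)
        · exact definable_and (definable_mem hDA _) <| definable_ex <|
            definable_and (definable_mem hsA _) <| definable_and (definable_rel (hlt _) _ _) <|
            definable_all <| definable_imp (definable_mem hDA _) <|
            definable_imp (definable_rel (hlt _) _ _) (definable_not (definable_rel (hlt _) _ _))
        · rintro x ⟨hx, y, rfl, hxy, h⟩
          exact le_antisymm (not_lt.1 fun hcx => hmin x hx hcx hxy)
            (not_lt.1 fun hxc => h c hcD hxc hcs)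
      have hs' : s ∈ dcl L (insert c (A : Set M)) := by
        have hD' := Definable.mono hDA (subset_insert c (A : Set M))
        have hc' : (insert c (A : Set M)).Definable₁ L {c} := subset_dcl _ (mem_insert _ _)
        refine mem_dcl_of_unique (p := fun x => x ∈ D ∧ ∃ y, y ∈ ({c} : Set M) ∧ y < x ∧
          ∀ z, z ∈ D → y < z → ¬ z < x) (definable₁_of ?_) ⟨hs, c, rfl, hcs, hmin⟩ ?_
        · exact definable_and (definable_mem hD' _) <| definable_ex <|
            definable_and (definable_mem hc' _) <| definable_and (definable_rel (hlt _) _ _) <|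
            definable_all <| definable_imp (definable_mem hD' _) <|
            definable_imp (definable_rel (hlt _) _ _) (definable_not (definable_rel (hlt _) _ _))
        · rintro x ⟨hx, y, rfl, hyx, h⟩
          exact le_antisymm (not_lt.1 fun hsx => h s hs hcs hsx)
            (not_lt.1 fun hxs => hmin x hx hyx hxs)
      rw [hdcl _ (insert_nonempty _ _), mem_iUnion₂] at hs'
      obtain ⟨a, ha, hsa⟩ := hs'
      rcases mem_insert_iff.1 ha with rfl | ha
      · exact ⟨s, ⟨hs, hP.isModel.dcl_subset (singleton_subset_iff.2 hcP) hsa, hsA⟩, hcs, hmin⟩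
      · exact absurd (dcl_mono (singleton_subset_iff.2 ha) hsa) hsA
  obtain ⟨c, hcD, hcP, hc⟩ : ∃ c, c ∈ D ∧ c ∈ P ∧ c ∉ dcl L (A : Set M) := by
    -- Parameters are taken from all of `dcl A`, still a small set, so that every finite subset of
    -- it can be removed from `D ∩ P`.
    obtain ⟨x, hx⟩ := hP.exists_forall_mem
      (A := dcl L (A : Set M)) (card_dcl_lt hAcard hP.aleph0_lt hP.card_lt)
      (F := {S | ∃ F : Finset M, (F : Set M) ⊆ dcl L (A : Set M) ∧ S = (D ∩ P) \ F})
      ⟨_, ∅, by simp, rfl⟩ (by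
        rintro _ ⟨F, hF, rfl⟩
        exact definable₁_of (M := Pair P) (definable_and (definable_and
          (definable_mem (definable₁_pair (Definable.mono hDA (subset_dcl _))) _)
          (definable_mem (definable₁_pred _) _))
          (definable_not (definable_mem (definable₁_pair
            (definable₁_of_finite F.finite_toSet (hF.trans (subset_dcl _)))) _)))) (by
        classical
        rintro _ ⟨F, hF, rfl⟩ _ ⟨G, hG, rfl⟩
        refine ⟨_, ⟨F ∪ G, by simp [hF, hG], rfl⟩, ?_⟩
        rintro x ⟨hx, hx'⟩
        rw [Finset.coe_union, mem_union, not_or] at hx'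
        exact ⟨⟨hx, hx'.1⟩, hx, hx'.2⟩) (by
        rintro _ ⟨F, hF, rfl⟩
        obtain ⟨x, hx, hxP⟩ := hP.isModel.exists_mem (X := D \ F)
          (Definable.sdiff (hDA.mono (subset_univ _))
            (definable₁_of_finite F.finite_toSet fun x _ => subset_dcl _ trivial)) (Infinite.sdiff hinf F.finite_toSet)
        exact ⟨x, ⟨hx.1, hxP⟩, hx.2⟩)
    refine ⟨x, (hx _ ⟨∅, by simp, rfl⟩).1.1, (hx _ ⟨∅, by simp, rfl⟩).1.2, fun hxA => ?_⟩
    exact (hx _ ⟨{x}, by simpa using hxA, rfl⟩).2 (by simp)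
  choose! s hs hlt_s hmin_s using step
  let f : ℕ → M := fun n => s^[n] c
  have hf : ∀ n, f n ∈ D ∧ f n ∈ P ∧ f n ∉ dcl L (A : Set M) := by
    intro n
    induction n with
    | zero => exact ⟨hcD, hcP, hc⟩
    | succ n ih =>
      simp only [f, Function.iterate_succ_apply']
      exact hs _ ih
  have hfs : ∀ n, f (n + 1) = s (f n) := fun n => Function.iterate_succ_apply' s n c
  have hmono : StrictMono f := strictMono_nat_of_lt_succ fun n => by
    rw [hfs]
    exact hlt_s _ (hf n)
  have hmem : ∀ n, ∀ y ∈ D, f 0 ≤ y → y ≤ f n → y ∈ P := by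
    intro n
    induction n with
    | zero => exact fun y _ h h' => le_antisymm h h' ▸ (hf 0).2.1
    | succ n ih =>
      intro y hy h h'
      rcases le_or_gt y (f n) with hyn | hyn
      · exact ih y hy h hyn
      · rw [hfs] at h'
        rw [le_antisymm h' (not_lt.1 (hmin_s _ (hf n) y hy hyn)), ← hfs]
        exact (hf _).2.1
  let B : Set M := (A : Set M) ∪ range f
  have hDB : B.Definable₁ L D := Definable.mono hDA subset_union_left
  have hfB : ∀ n, B.Definable₁ L {f n} := fun n => subset_dcl _ (Or.inr ⟨n, rfl⟩)
  -- The point `x` lies above every `f n`, while all of `D` between `f 0` and `x` is in `P`. The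
  -- conditions are over a countable set, and `f (n + 1)` satisfies the `n`-th.
  obtain ⟨x, hx⟩ := hP.exists_forall_mem
    (A := B) (lt_of_le_of_lt (mk_le_aleph0_iff.2 (A.countable_toSet.union (countable_range f)))
      hP.aleph0_lt)
    (F := {S | ∃ n, S = {x : M | (∀ y : M, y ∈ D ∩ Ici (f 0) → ¬ x < y → y ∈ P) ∧ x ∈ Ioi (f n)}})
    ⟨_, 0, rfl⟩ (by
      rintro _ ⟨n, rfl⟩
      refine definable₁_of (M := Pair P) (definable_and (definable_all
        (definable_imp (definable_mem (definable₁_pair ?_) _) (definable_imp ?_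
        (definable_mem (definable₁_pred _) _)))) (definable_mem (definable₁_pair ?_) _))
      · exact Definable.inter hDB (hM.definable₁_Ici (Or.inr ⟨0, rfl⟩))
      · exact definable_not (definable_rel (M := Pair P) (G := fun x y : M => x < y)
          (definable₂_pair (hlt B)) _ _)
      · exact hM.definable₁_Ioi (Or.inr ⟨n, rfl⟩)) (by
      rintro _ ⟨n, rfl⟩ _ ⟨m, rfl⟩
      refine ⟨_, ⟨max n m, rfl⟩, fun x hx => ⟨⟨hx.1, ?_⟩, hx.1, ?_⟩⟩
      · exact (hmono.monotone (le_max_left n m)).trans_lt hx.2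
      · exact (hmono.monotone (le_max_right n m)).trans_lt hx.2) (by
      rintro _ ⟨n, rfl⟩
      exact ⟨f (n + 1), fun y hy h => hmem (n + 1) y hy.1 hy.2 (not_lt.1 h),
        hmono n.lt_succ_self⟩)
  have hfx : ∀ n, f n < x := fun n => (hx _ ⟨n, rfl⟩).2
  obtain ⟨y, hy, hyP⟩ := hP.isModel.exists_notMem (X := (D ∩ Ici (f 0)) ∩ Iic x)
    (Definable.inter (Definable.inter (hDA.mono (subset_univ _)) (hM.definable₁_Ici trivial))
      (hM.definable₁_Iic trivial))
    (infinite_of_injective_forall_mem hmono.injective fun n =>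
      ⟨⟨(hf n).1, hmono.monotone n.zero_le⟩, (hfx n).le⟩)
  exact hyP ((hx _ ⟨0, rfl⟩).1 y hy.1 (not_lt.2 hy.2))

theorem IsMonsterLovelyPair.exists_left (hP : IsMonsterLovelyPair T P) (hM : TameOrder L M)
    (hdcl : ∀ A : Set M, A.Nonempty → dcl L A = ⋃ a ∈ A, dcl L {a}) {A X : Set M}
    (hX : A.Definable₁ L X) {b : M} (hb : b ∉ dcl L A) (hbX : b ∈ X) :
    ∃ u, u < b ∧ ∀ z, u < z → z < b → z ∈ X := by
  by_contra h
  exact hb (mem_dcl_of_finite (hM.definable₂_lt A) (hM.definable₁_leftEnds hX)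
    (hP.finite_leftEnds hM hdcl (hX.mono (subset_univ _))) ⟨hbX, h⟩)

/-- Let `G` be the graph of a `∅`-definable partial function sending `a₀` to `a`. Its fibre over `a`
contains an interval to the left of `a₀`. The left endpoint of the maximal such interval turns out
to be in `dcl ∅`, and `a` is the value of the function just to its right. -/
theorem IsMonsterLovelyPair.exchange [DenselyOrdered M] (hP : IsMonsterLovelyPair T P) (hM : TameOrder L M)
    (hdcl : ∀ A : Set M, A.Nonempty → dcl L A = ⋃ a ∈ A, dcl L {a}) {a₀ a : M}
    (ha : a ∈ dcl L {a₀}) (ha₀ : a₀ ∉ dcl L {a}) : a ∈ dcl L (∅ : Set M) := by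
  obtain ⟨G, hG, hfun, hGa⟩ := definable₂_graph ha
  have hlt := hM.definable₂_lt
  obtain ⟨u, hu, hGu⟩ := hP.exists_left hM hdcl (A := {a}) (X := {x | G x a}) (definable₁_of (by
    have : {v : Fin 1 → M | G (v 0) a} = {v | ∃ y, y ∈ ({a} : Set M) ∧ G (v 0) y} := by
      ext; simp
    rw [this]
    exact definable_ex <| definable_and (definable_mem (subset_dcl _ (mem_singleton a)) _)
      (definable_rel (hG.mono (empty_subset _)) _ _))) ha₀ hGa
  -- The supremum of these `v` is the left endpoint `e` of the maximal interval below `a₀` on which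
  -- the function is constantly `a`. If there is no such `v`, the interval is unbounded to the left
  -- or omits at most the minimum.
  by_cases hV : ∃ v, ∃ w, v < w ∧ w < a₀ ∧ ¬ G w a
  · obtain ⟨e, heub, he⟩ := hM.exists_sup {v | ∃ w, v < w ∧ w < a₀ ∧ ¬ G w a} (by
      have : {v | ∃ w, v < w ∧ w < a₀ ∧ ¬ G w a} =
          {v | ∃ w, v < w ∧ w ∈ Iio a₀ ∧ ∃ y, y ∈ ({a} : Set M) ∧ ¬ G w y} := by
        ext; simp
      rw [this]
      exact definable₁_of <| definable_ex <| definable_and (definable_rel (hlt _) _ _) <|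
        definable_and (definable_mem (hM.definable₁_Iio (mem_univ a₀)) _) <| definable_ex <|
        definable_and (definable_mem (subset_dcl _ (mem_univ a)) _)
        (definable_not (definable_rel (hG.mono (empty_subset _)) _ _))) hV
      ⟨u, fun v ⟨w, hvw, hw, hGw⟩ huv => hGw (hGu w (huv.trans hvw) hw)⟩
    have hea : e < a₀ := by
      refine lt_of_le_of_lt (not_lt.1 fun hue => ?_) hu
      obtain ⟨v, ⟨w, hvw, hw, hGw⟩, huv⟩ := he u hue
      exact hGw (hGu w (huv.trans hvw) hw)
    have hGe : ∀ w, e < w → w < a₀ → G w a := by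
      intro w hew hw
      by_contra hGw
      obtain ⟨v, hev, hvw⟩ := exists_between hew
      exact heub v ⟨w, hvw, hw, hGw⟩ hev
    -- `E` consists of the left endpoints of maximal intervals of constancy, with the value `y`
    -- quantified away so that no parameter remains.
    let E : Set M := {e | ∃ t, e < t ∧ ∃ y, (∀ w, e < w → w < t → G w y) ∧
      ∀ v, v < e → ∃ w, v < w ∧ w < t ∧ ¬ G w y}
    have hE : (∅ : Set M).Definable₁ L E := definable₁_of <| definable_ex <|
      definable_and (definable_rel (hlt _) _ _) <| definable_ex <|
      definable_and (definable_all <| definable_imp (definable_rel (hlt _) _ _) <|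
        definable_imp (definable_rel (hlt _) _ _) (definable_rel hG _ _)) <|
      definable_all <| definable_imp (definable_rel (hlt _) _ _) <| definable_ex <|
      definable_and (definable_rel (hlt _) _ _) <| definable_and (definable_rel (hlt _) _ _) <|
      definable_not (definable_rel hG _ _)
    have heE : e ∈ E := by
      refine ⟨a₀, hea, a, hGe, fun v hv => ?_⟩
      obtain ⟨v', ⟨w, hvw, hw⟩, hvv'⟩ := he v hv
      exact ⟨w, hvv'.trans hvw, hw⟩
    have hedcl : e ∈ dcl L (∅ : Set M) := by
      by_contra hedcl
      obtain ⟨u', hu', hE'⟩ := hP.exists_left hM hdcl hE hedcl heE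
      -- Two points `e₁ < e₂` of `E` are chosen so close that their intervals of constancy overlap.
      -- The values agree, so the function is constant across `e₂`, contradicting maximality there.
      obtain ⟨e₁, hue₁, he₁⟩ := exists_between hu'
      obtain ⟨t₁, het₁, y₁, hy₁, -⟩ := hE' e₁ hue₁ he₁
      obtain ⟨e₂, he₁₂, he₂⟩ := exists_between (lt_min het₁ he₁)
      obtain ⟨t₂, het₂, y₂, hy₂, hleft⟩ :=
        hE' e₂ (hue₁.trans he₁₂) (he₂.trans_le (min_le_right _ _))
      obtain ⟨w, hw, hw'⟩ := exists_between (lt_min (he₂.trans_le (min_le_left _ _)) het₂)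
      obtain rfl : y₁ = y₂ := hfun w _ _
        (hy₁ w (he₁₂.trans hw) (hw'.trans_le (min_le_left _ _)))
        (hy₂ w hw (hw'.trans_le (min_le_right _ _)))
      obtain ⟨w', hw₁, hw₂, hGw'⟩ := hleft e₁ he₁₂
      rcases lt_or_ge w' t₁ with h | h
      · exact hGw' (hy₁ w' hw₁ h)
      · exact hGw' (hy₂ w' ((he₂.trans_le (min_le_left _ _)).trans_le h) hw₂)
    refine mem_dcl_of_unique (p := fun y => ∃ e', e' ∈ ({e} : Set M) ∧ ∃ t, e' < t ∧
      ∀ w, e' < w → w < t → G w y) (definable₁_of ?_) ⟨e, rfl, a₀, hea, hGe⟩ ?_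
    · exact definable_ex <| definable_and (definable_mem hedcl _) <| definable_ex <|
        definable_and (definable_rel (hlt _) _ _) <| definable_all <|
        definable_imp (definable_rel (hlt _) _ _) <|
        definable_imp (definable_rel (hlt _) _ _) (definable_rel hG _ _)
    · rintro y ⟨e', rfl, t, het, hy⟩
      obtain ⟨w, hw, hw'⟩ := exists_between (lt_min het hea)
      exact hfun w _ _ (hy w hw (hw'.trans_le (min_le_left _ _)))
        (hGe w hw (hw'.trans_le (min_le_right _ _)))
  · push Not at hV
    obtain ⟨w₀, huw₀, hw₀⟩ := exists_between hu
    -- Here `a` is the value on an initial segment without its possible minimum; the requirement of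
    -- some `v < w < t` keeps the segment from being vacuous.
    refine mem_dcl_of_unique (p := fun y => ∃ t, (∃ v, ∃ w, v < w ∧ w < t) ∧
      ∀ v w, v < w → w < t → G w y) (definable₁_of ?_) ⟨a₀, ⟨u, w₀, huw₀, hw₀⟩, hV⟩ ?_
    · exact definable_ex <| definable_and (definable_ex <| definable_ex <|
        definable_and (definable_rel (hlt _) _ _) (definable_rel (hlt _) _ _)) <|
        definable_all <| definable_all <| definable_imp (definable_rel (hlt _) _ _) <|
        definable_imp (definable_rel (hlt _) _ _) (definable_rel hG _ _)
    · rintro y ⟨t, ⟨v, w, hvw, hw⟩, hy⟩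
      rcases le_total w w₀ with h | h
      · exact hfun w _ _ (hy v w hvw hw) (hV v w hvw (h.trans_lt hw₀))
      · exact hfun w₀ _ _ (hy u w₀ huw₀ (h.trans_lt hw)) (hV u w₀ huw₀ hw₀)

end Order

/-! ### Transfinite back-and-forth -/

section BackAndForth

/-- Transfinite back-and-forth for a property of relations that is preserved by directed unions. -/
theorem exists_total_rel {M : Type w} (hM : ℵ₀ ≤ #M) {Good : Set (M × M) → Prop}
    (empty : Good ∅)
    (union : ∀ F : Set (Set (M × M)), F.Nonempty → DirectedOn (· ⊆ ·) F → (∀ R ∈ F, Good R) →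
      Good (⋃₀ F))
    (forth : ∀ R, Good R → #R < #M → ∀ a, ∃ b, Good (insert (a, b) R))
    (back : ∀ R, Good R → #R < #M → ∀ b, ∃ a, Good (insert (a, b) R)) :
    ∃ R, Good R ∧ (∀ a, ∃ b, (a, b) ∈ R) ∧ ∀ b, ∃ a, (a, b) ∈ R := by
  have step : ∀ (R : Set (M × M)) (m : M), ∃ p : M × M, Good R → #R < #M →
      Good (insert (p.2, m) (insert (m, p.1) R)) := by
    intro R m
    by_cases h : Good R ∧ #R < #M
    · obtain ⟨b, hb⟩ := forth R h.1 h.2 m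
      obtain ⟨a, ha⟩ := back _ hb (mk_insert_le.trans_lt
        (add_lt_of_lt hM h.2 (one_lt_aleph0.trans_le hM))) m
      exact ⟨(b, a), fun _ _ => ha⟩
    · exact ⟨(m, m), fun h₁ h₂ => absurd ⟨h₁, h₂⟩ h⟩
  choose ext hext using step
  -- `M` is well-ordered in its least order type, so that initial segments, and hence the relations
  -- built at earlier stages, are small. Stage `m` puts `m` into both the domain and the range.
  obtain ⟨r, hr, hord⟩ := Cardinal.exists_ord_eq M
  have hwf : WellFounded r := hr.wf
  let below : (m : M) → ((j : M) → r j m → M × M) → Set (M × M) := fun m f =>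
    {p | ∃ (j : M) (h : r j m), p = (j, (f j h).1) ∨ p = ((f j h).2, j)}
  let F : M → M × M := hwf.fix fun m f => ext (below m f) m
  let R : M → Set (M × M) := fun m => below m fun j _ => F j
  have hF : ∀ m, F m = ext (R m) m := fun m => hwf.fix_eq _ m
  let R' : M → Set (M × M) := fun m => insert ((F m).2, m) (insert (m, (F m).1) (R m))
  have hlt : ∀ j m, r j m → R' j ⊆ R m := by
    rintro j m hjm p (rfl | rfl | ⟨i, hij, hp⟩)
    · exact ⟨j, hjm, Or.inr rfl⟩
    · exact ⟨j, hjm, Or.inl rfl⟩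
    · exact ⟨i, _root_.trans hij hjm, hp⟩
  have hle : ∀ m, R m ⊆ R' m := fun m => (subset_insert _ _).trans (subset_insert _ _)
  have hdir : ∀ s : Set M, DirectedOn (· ⊆ ·) (R' '' s) := by
    rintro s _ ⟨j, hj, rfl⟩ _ ⟨k, hk, rfl⟩
    rcases trichotomous_of r j k with h | rfl | h
    · exact ⟨_, ⟨k, hk, rfl⟩, (hlt _ _ h).trans (hle _), subset_rfl⟩
    · exact ⟨_, ⟨j, hj, rfl⟩, subset_rfl, subset_rfl⟩
    · exact ⟨_, ⟨j, hj, rfl⟩, subset_rfl, (hlt _ _ h).trans (hle _)⟩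
  have hcard : ∀ m, #(R m) < #M := by
    intro m
    have hsub : R m ⊆ (fun j => (j, (F j).1)) '' {j | r j m} ∪
        (fun j => ((F j).2, j)) '' {j | r j m} := by
      rintro p ⟨j, hj, rfl | rfl⟩
      · exact Or.inl ⟨j, hj, rfl⟩
      · exact Or.inr ⟨j, hj, rfl⟩
    have hseg : #{j | r j m} < #M := Cardinal.card_typein_lt m hord
    exact (mk_le_mk_of_subset hsub).trans_lt ((mk_union_le _ _).trans_lt
      (add_lt_of_lt hM (mk_image_le.trans_lt hseg) (mk_image_le.trans_lt hseg)))
  have hgood : ∀ m, Good (R' m) := by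
    intro m
    induction m using hwf.induction with
    | _ m ih =>
      have hR : Good (R m) := by
        by_cases h : ∃ j, r j m
        · have : R m = ⋃₀ (R' '' {j | r j m}) := by
            refine subset_antisymm ?_ (sUnion_subset ?_)
            · rintro p ⟨j, hj, hp⟩
              refine ⟨_, ⟨j, hj, rfl⟩, ?_⟩
              rcases hp with rfl | rfl
              · exact mem_insert_of_mem _ (mem_insert _ _)
              · exact mem_insert _ _
            · rintro _ ⟨j, hj, rfl⟩
              exact hlt j m hj
          rw [this]
          refine union _ (Set.Nonempty.image _ h) (hdir _) ?_
          rintro _ ⟨j, hj, rfl⟩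
          exact ih j hj
        · have : R m = ∅ := eq_empty_of_forall_notMem fun p ⟨j, hj, _⟩ => h ⟨j, hj⟩
          rwa [this]
      have := hext (R m) m hR (hcard m)
      rwa [← hF] at this
  have : Infinite M := infinite_iff.2 hM
  refine ⟨⋃₀ (R' '' univ), union _ (univ_nonempty.image _) (hdir _) ?_, fun a => ?_, fun b => ?_⟩
  · rintro _ ⟨j, _, rfl⟩
    exact hgood j
  · exact ⟨_, _, ⟨a, trivial, rfl⟩, mem_insert_of_mem _ (mem_insert _ _)⟩
  · exact ⟨_, _, ⟨b, trivial, rfl⟩, mem_insert _ _⟩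

end BackAndForth

/-! ### Partial elementary relations and transported types -/

section ElementaryRelation

variable {L : FirstOrder.Language.{u, v}} {T : L.Theory} {M : Type w} [L.Structure M] {P : Set M}

/-- The relation `R` relates tuples of the same type. -/
def IsElementaryRel (L : FirstOrder.Language.{u, v}) {M : Type w} [L.Structure M]
    (R : Set (M × M)) : Prop :=
  ∀ (n : ℕ) (φ : L.Formula (Fin n)) (r : Fin n → M × M), (∀ i, r i ∈ R) →
    φ.Realize (fun i => (r i).1) → φ.Realize fun i => (r i).2

/-- The sets that are defined by the formulas in the type of `a` over the domain of `R`, after the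
transport of their parameters along `R`. -/
def typeSets (L : FirstOrder.Language.{u, v}) {M : Type w} [L.Structure M] (R : Set (M × M))
    (a : M) : Set (Set M) :=
  {Y | ∃ (n : ℕ) (φ : L.Formula (Fin n ⊕ Unit)) (r : Fin n → M × M), (∀ i, r i ∈ R) ∧
    φ.Realize (Sum.elim (fun i => (r i).1) fun _ => a) ∧
    Y = {x | φ.Realize (Sum.elim (fun i => (r i).2) fun _ => x)}}

variable {R : Set (M × M)} {a b : M}

theorem isElementaryRel_empty : IsElementaryRel L (∅ : Set (M × M)) := by
  intro n φ r hr h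
  rwa [show (fun i => (r i).2) = fun i => (r i).1 from funext fun i => (hr i).elim]

theorem IsElementaryRel.iff (h : IsElementaryRel L R) {n : ℕ} (φ : L.Formula (Fin n))
    (r : Fin n → M × M) (hr : ∀ i, r i ∈ R) :
    φ.Realize (fun i => (r i).1) ↔ φ.Realize fun i => (r i).2 := by
  refine ⟨h n φ r hr, fun h' => ?_⟩
  by_contra h''
  exact h n φ.not r hr (Formula.realize_not.2 h'') h'

theorem IsElementaryRel.swap (h : IsElementaryRel L R) : IsElementaryRel L (Prod.swap ⁻¹' R) :=
  fun _ φ r hr => (h.iff φ (fun i => (r i).swap) hr).2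

theorem IsElementaryRel.mono {R' : Set (M × M)} (h : IsElementaryRel L R) (hR : R' ⊆ R) :
    IsElementaryRel L R' := fun n φ r hr => h n φ r fun i => hR (hr i)

theorem isElementaryRel_sUnion {F : Set (Set (M × M))} (hne : F.Nonempty)
    (hdir : DirectedOn (· ⊆ ·) F) (h : ∀ R ∈ F, IsElementaryRel L R) :
    IsElementaryRel L (⋃₀ F) := by
  intro n φ r hr
  obtain ⟨R, hR, hrR⟩ := hdir.exists_mem_subset_of_finite_of_subset_sUnion hne
    (finite_range r) (by rintro _ ⟨i, rfl⟩; exact hr i)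
  exact h R hR n φ r fun i => hrR ⟨i, rfl⟩

theorem isElementaryRel_insert (h : ∀ Y ∈ typeSets L R a, b ∈ Y) :
    IsElementaryRel L (insert (a, b) R) := by
  classical
  intro n φ r hr hφ
  let e := Finite.equivFin {i // r i ∈ R}
  -- Entries of the tuple outside `R` all equal `(a, b)` and share the single extra variable.
  let f : Fin n → Fin (Nat.card {i // r i ∈ R}) ⊕ Unit := fun i =>
    if h : r i ∈ R then .inl (e ⟨i, h⟩) else .inr ()
  have hf : ∀ (π : M × M → M) (i : Fin n),
      Sum.elim (fun j => π (r (e.symm j))) (fun _ => π (a, b)) (f i) = π (r i) := by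
    intro π i
    by_cases hi : r i ∈ R
    · simp [f, hi]
    · simp only [f, dif_neg hi, Sum.elim_inr, (hr i).resolve_right hi]
  have := h _ ⟨_, φ.relabel f, fun j => r (e.symm j), fun j => (e.symm j).2, by
    rw [Formula.realize_relabel]
    exact (congrArg φ.Realize (funext (hf Prod.fst))).mpr hφ, rfl⟩
  rw [mem_ofPred_eq, Formula.realize_relabel] at this
  exact (congrArg φ.Realize (funext (hf Prod.snd))).mp this

theorem IsElementaryRel.realize_elim (h : IsElementaryRel L R) (hab : (a, b) ∈ R) {n : ℕ}
    (φ : L.Formula (Fin n ⊕ Unit)) (r : Fin n → M × M) (hr : ∀ i, r i ∈ R)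
    (hφ : φ.Realize (Sum.elim (fun i => (r i).1) fun _ => a)) :
    φ.Realize (Sum.elim (fun i => (r i).2) fun _ => b) := by
  let f : Fin n ⊕ Unit → Fin (n + 1) := Sum.elim Fin.castSucc fun _ => Fin.last n
  have hf : ∀ π : M × M → M, (fun i => π (Fin.snoc (α := fun _ => M × M) r (a, b) i)) ∘ f =
      Sum.elim (fun i => π (r i)) fun _ => π (a, b) := by
    intro π
    ext i
    cases i <;> simp [f]
  have := h (n + 1) (φ.relabel f) (Fin.snoc (α := fun _ => M × M) r (a, b)) (by
    intro i
    refine Fin.lastCases ?_ (fun i => ?_) i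
    · simpa using hab
    · simpa using hr i)
  rw [Formula.realize_relabel, Formula.realize_relabel, hf Prod.fst, hf Prod.snd] at this
  exact this hφ

theorem mem_typeSets (h : IsElementaryRel L (insert (a, b) R)) {Y : Set M}
    (hY : Y ∈ typeSets L R a) : b ∈ Y := by
  obtain ⟨n, φ, r, hr, hφ, rfl⟩ := hY
  exact h.realize_elim (mem_insert _ _) φ r (fun i => mem_insert_of_mem _ (hr i)) hφ

theorem definable₁_typeSets {Y : Set M} (hY : Y ∈ typeSets L R a) :
    (Prod.snd '' R).Definable₁ L Y := by
  obtain ⟨n, φ, r, hr, hφ, rfl⟩ := hY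
  exact definable₁_iff.2 ⟨n, φ, _, fun i => ⟨r i, hr i, rfl⟩, rfl⟩

theorem typeSets_nonempty : (typeSets L R a).Nonempty :=
  ⟨_, 0, ⊤, Fin.elim0, fun i => i.elim0, by simp, rfl⟩

theorem typeSets_inter {Y Z : Set M} (hY : Y ∈ typeSets L R a) (hZ : Z ∈ typeSets L R a) :
    Y ∩ Z ∈ typeSets L R a := by
  obtain ⟨n, φ, r, hr, hφ, rfl⟩ := hY
  obtain ⟨m, ψ, s, hs, hψ, rfl⟩ := hZ
  have h₁ : ∀ (π : M × M → M) (x : M), (Sum.elim (fun i => π (Fin.append r s i)) fun _ => x) ∘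
      Sum.map (Fin.castAdd m) id = Sum.elim (fun i => π (r i)) fun _ : Unit => x := by
    intro π x
    ext i
    cases i <;> simp
  have h₂ : ∀ (π : M × M → M) (x : M), (Sum.elim (fun i => π (Fin.append r s i)) fun _ => x) ∘
      Sum.map (Fin.natAdd n) id = Sum.elim (fun i => π (s i)) fun _ : Unit => x := by
    intro π x
    ext i
    cases i <;> simp
  refine ⟨n + m, φ.relabel (Sum.map (Fin.castAdd m) id) ⊓ ψ.relabel (Sum.map (Fin.natAdd n) id),
    Fin.append r s, fun i => ?_, ?_, ?_⟩
  · refine Fin.addCases (fun i => ?_) (fun i => ?_) i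
    · simpa using hr i
    · simpa using hs i
  · rw [Formula.realize_inf, Formula.realize_relabel, Formula.realize_relabel, h₁ Prod.fst,
      h₂ Prod.fst]
    exact ⟨hφ, hψ⟩
  · ext x
    rw [mem_ofPred_eq, Formula.realize_inf, Formula.realize_relabel, Formula.realize_relabel,
      h₁ Prod.snd, h₂ Prod.snd]
    rfl

theorem IsElementaryRel.nonempty_typeSets (h : IsElementaryRel L R) {Y : Set M}
    (hY : Y ∈ typeSets L R a) : Y.Nonempty := by
  obtain ⟨n, φ, r, hr, hφ, rfl⟩ := hY
  have := h n (φ.iExs Unit) r hr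
  rw [Formula.realize_iExs, Formula.realize_iExs] at this
  obtain ⟨x, hx⟩ := this ⟨fun _ => a, hφ⟩
  exact ⟨x (), hx⟩

theorem IsElementaryRel.mem_dcl (h : IsElementaryRel L R) (hab : (a, b) ∈ R) {S : Set (M × M)}
    (hS : S ⊆ R) (ha : a ∈ dcl L (Prod.fst '' S)) : b ∈ dcl L (Prod.snd '' S) := by
  obtain ⟨n, φ, x, hx, h'⟩ := definable₁_iff.1 ha
  choose r hr hrx using hx
  obtain rfl : (fun i => (r i).1) = x := funext hrx
  have key : ∀ y, φ.Realize (Sum.elim (fun i => (r i).1) fun _ => y) ↔ y = a :=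
    fun y => (Set.ext_iff.1 h' y).symm
  -- Uniqueness of the solution is made part of the formula, so that it is transported along `R` as
  -- well.
  let ψ : L.Formula (Fin n ⊕ Unit) := φ ⊓ Formula.iAlls Unit
    ((φ.relabel (Sum.map Sum.inl id) : L.Formula ((Fin n ⊕ Unit) ⊕ Unit)).imp
      (Term.equal (Term.var (.inr ())) (Term.var (.inl (.inr ())))))
  have hψ : ∀ (z : Fin n → M) (y : M), ψ.Realize (Sum.elim z fun _ => y) ↔
      φ.Realize (Sum.elim z fun _ => y) ∧
        ∀ y', φ.Realize (Sum.elim z fun _ => y') → y' = y := by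
    intro z y
    have hc : ∀ i : Unit → M, (Sum.elim (Sum.elim z fun _ : Unit => y) i) ∘ Sum.map Sum.inl id =
        Sum.elim z fun _ => i () := by
      intro i
      ext j
      cases j <;> rfl
    simp only [ψ, Formula.realize_inf, Formula.realize_iAlls, Formula.realize_imp,
      Formula.realize_relabel, Formula.realize_equal, Term.realize_var, Sum.elim_inr,
      Sum.elim_inl]
    refine and_congr_right fun _ => ⟨fun H y' hy' => H (fun _ => y') ?_,
      fun H i hi => H (i ()) ?_⟩
    · have := hc fun _ => y'
      rw [← this] at hy'
      exact hy'
    · rw [← hc]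
      exact hi
  have := (hψ (fun i => (r i).2) b).1 (h.realize_elim hab ψ r (fun i => hS (hr i))
    ((hψ (fun i => (r i).1) a).2 ⟨(key a).2 rfl, fun y hy => (key y).1 hy⟩))
  have hdef : (Prod.snd '' S).Definable₁ L
      {y | φ.Realize (Sum.elim (fun i => (r i).2) fun _ => y)} :=
    definable₁_iff.2 ⟨n, φ, _, fun i => ⟨r i, hr i, rfl⟩, rfl⟩
  exact mem_dcl_of_unique hdef this.1 this.2

theorem IsMonsterLovelyPair.exists_insert (hP : IsMonsterLovelyPair T P)
    (hR : IsElementaryRel L R) (hcard : #R < #M) (a : M) :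
    ∃ b, IsElementaryRel L (insert (a, b) R) := by
  obtain ⟨b, hb⟩ := hP.exists_forall_mem (A := Prod.snd '' R) (mk_image_le.trans_lt hcard)
    (F := typeSets L R a) typeSets_nonempty (fun S hS => definable₁_pair (definable₁_typeSets hS))
    (fun S hS T hT => ⟨_, typeSets_inter hS hT, subset_rfl⟩) fun S hS => hR.nonempty_typeSets hS
  exact ⟨b, isElementaryRel_insert hb⟩

end ElementaryRelation

/-! ### Tameness of all predicates in `e(P)` -/

section TamePredicate

variable {L : FirstOrder.Language.{u, v}} {T : L.Theory} {M : Type w} [L.Structure M] {P : Set M}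

theorem Codefinable.map_expansion {L' : FirstOrder.Language.{u, v}} (ϕ : L →ᴸ L') {N : Type w'}
    [L.Structure N] [L'.Structure N] [L'.Structure M] [ϕ.IsExpansionOn N] [ϕ.IsExpansionOn M]
    {α : Type*} {p : (α → N) → Prop} {q : (α → M) → Prop} (h : Codefinable L p q) :
    Codefinable L' p q := by
  obtain ⟨φ, h₁, h₂⟩ := h
  exact ⟨ϕ.onFormula φ, fun v => by rw [h₁, LHom.realize_onFormula],
    fun v => by rw [h₂, LHom.realize_onFormula]⟩

theorem codefinable_pred (P P' : Set M) {α : Type*} (i : α) :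
    Codefinable (pairLanguage L) (N := Pair P) (M := Pair P') (fun v => (v i : M) ∈ P)
      fun v => (v i : M) ∈ P' := by
  refine ⟨Relations.formula₁ (L := pairLanguage L) (.inr PredSymbol.P) (Term.var i),
    fun v => ?_, fun v => ?_⟩
  · exact (Formula.realize_rel₁ (L := pairLanguage L) (M := Pair P) (R := .inr PredSymbol.P)
      (t := Term.var i) (v := v)).symm
  · exact (Formula.realize_rel₁ (L := pairLanguage L) (M := Pair P') (R := .inr PredSymbol.P)
      (t := Term.var i) (v := v)).symm

theorem IsModelOfLovelyPairTheory.isTamePredicate [LinearOrder M] [DenselyOrdered M]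
    (hP : IsModelOfLovelyPairTheory T P) (hM : TameOrder L M) : IsTamePredicate L P := by
  have hdef : ∀ x y : M, (univ : Set M).Definable₁ L (Ioo x y) := fun x y =>
    Definable.inter (hM.definable₁_Ioi trivial) (hM.definable₁_Iio trivial)
  refine ⟨fun x y hxy => ?_, fun x y hxy => ?_, hP.dcl_subset (empty_subset _),
    fun p hp => hP.dcl_subset (singleton_subset_iff.2 hp)⟩
  · obtain ⟨z, hz, hzP⟩ := hP.exists_mem (hdef x y) (Ioo_infinite hxy)
    exact ⟨z, hz.1, hz.2, hzP⟩
  · obtain ⟨z, hz, hzP⟩ := hP.exists_notMem (hdef x y) (Ioo_infinite hxy)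
    exact ⟨z, hz.1, hz.2, hzP⟩

/-- Density and codensity are single sentences. Closure under `dcl` of a point is obtained from
`helem` for constant tuples, one sentence per formula; the case of `dcl ∅` then follows from any
point of `P'`. -/
theorem IsTamePredicate.of_elementarilyEquivalent [LinearOrder M] [Nontrivial M]
    (hM : TameOrder L M) (hP : IsTamePredicate L P) {P' : Set M}
    (h : (pairLanguage L).ElementarilyEquivalent (Pair P) (Pair P'))
    (helem : ∀ (n : ℕ) (φ : L.Formula (Fin n ⊕ Unit)) (a : Fin n → M), (∀ i, a i ∈ P) →
      (∃ x : M, φ.Realize (Sum.elim a fun _ => x)) →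
      ∃ x ∈ P, φ.Realize (Sum.elim a fun _ => x)) : IsTamePredicate L P' := by
  let _ : LinearOrder (Pair P) := inferInstanceAs (LinearOrder M)
  let _ : LinearOrder (Pair P') := inferInstanceAs (LinearOrder M)
  have lt : ∀ {α : Type} (i j : α), Codefinable (pairLanguage L) (N := Pair P) (M := Pair P')
      (fun v => (v i : M) < v j) fun v => (v i : M) < v j := by
    intro α i j
    obtain ⟨φ, hφ⟩ := definable₂_iff.1 hM.definable_lt
    refine Codefinable.map_expansion (N := Pair P) (M := Pair P') LHom.sumInl
      ⟨φ.relabel ![i, j], fun v => ?_, fun v => ?_⟩ <;> rw [Formula.realize_relabel]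
    · exact (hφ (v ∘ ![i, j])).symm
    · exact (hφ (v ∘ ![i, j])).symm
  have hmem : ∀ x y : M, x < y → ∃ z, x < z ∧ z < y ∧ z ∈ P' :=
    Codefinable.transfer (L := pairLanguage L) (N := Pair P) (M := Pair P')
      (Codefinable.all (N := Pair P) (M := Pair P')
        (p := fun _ x => ∀ y : M, (x : M) < y → ∃ z, (x : M) < z ∧ z < y ∧ z ∈ P)
        (q := fun _ x => ∀ y : M, (x : M) < y → ∃ z, (x : M) < z ∧ z < y ∧ z ∈ P') <|
        Codefinable.all (N := Pair P) (M := Pair P') <| (lt _ _).imp <|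
        Codefinable.ex (N := Pair P) (M := Pair P') <|
        (lt _ _).and <| (lt _ _).and (codefinable_pred P P' _)) h
      (fun _ => hP.exists_mem) Empty.elim
  have hnotMem : ∀ x y : M, x < y → ∃ z, x < z ∧ z < y ∧ z ∉ P' :=
    Codefinable.transfer (L := pairLanguage L) (N := Pair P) (M := Pair P')
      (Codefinable.all (N := Pair P) (M := Pair P')
        (p := fun _ x => ∀ y : M, (x : M) < y → ∃ z, (x : M) < z ∧ z < y ∧ z ∉ P)
        (q := fun _ x => ∀ y : M, (x : M) < y → ∃ z, (x : M) < z ∧ z < y ∧ z ∉ P') <|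
        Codefinable.all (N := Pair P) (M := Pair P') <| (lt _ _).imp <|
        Codefinable.ex (N := Pair P) (M := Pair P') <|
        (lt _ _).and <| (lt _ _).and (codefinable_pred P P' _).not) h
      (fun _ => hP.exists_notMem) Empty.elim
  have hdcl : ∀ p ∈ P', dcl L {p} ⊆ P' := by
    intro p hp a ha
    obtain ⟨n, φ, b, hb, h'⟩ := definable₁_iff.1 ha
    obtain rfl : b = fun _ => p := funext hb
    have key : ∀ x, φ.Realize (Sum.elim (fun _ => p) fun _ => x) ↔ x = a :=
      fun x => (Set.ext_iff.1 h' x).symm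
    have real : ∀ {α : Type} (i j : α), Codefinable (pairLanguage L) (N := Pair P) (M := Pair P')
        (fun v => φ.Realize (M := Pair P) (Sum.elim (fun _ => v i) fun _ => v j))
        (fun v => φ.Realize (M := Pair P') (Sum.elim (fun _ => v i) fun _ => v j)) := fun i j =>
      Codefinable.map_expansion (N := Pair P) (M := Pair P') LHom.sumInl
        (Codefinable.realize_elim (N := Pair P) (M := Pair P') φ _ _)
    obtain ⟨x, hx, hφ⟩ := Codefinable.transfer (L := pairLanguage L) (N := Pair P) (M := Pair P')
      (Codefinable.all (N := Pair P) (M := Pair P')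
        (p := fun _ y => (y : M) ∈ P →
          (∃ x : Pair P, φ.Realize (M := Pair P) (Sum.elim (fun _ => y) fun _ => x)) →
          ∃ x : Pair P, (x : M) ∈ P ∧
            φ.Realize (M := Pair P) (Sum.elim (fun _ => y) fun _ => x))
        (q := fun _ y => (y : M) ∈ P' →
          (∃ x : Pair P', φ.Realize (M := Pair P') (Sum.elim (fun _ => y) fun _ => x)) →
          ∃ x : Pair P', (x : M) ∈ P' ∧
            φ.Realize (M := Pair P') (Sum.elim (fun _ => y) fun _ => x)) <|
        (codefinable_pred P P' _).imp <|
        (Codefinable.ex (N := Pair P) (M := Pair P') (real _ _)).imp <|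
        Codefinable.ex (N := Pair P) (M := Pair P') <|
        (codefinable_pred P P' _).and (real _ _)) h
      (fun _ y hy => helem n φ (fun _ => y) fun _ => hy) Empty.elim p hp ⟨a, (key a).2 rfl⟩
    rwa [← (key x).1 hφ]
  refine ⟨hmem, hnotMem, ?_, hdcl⟩
  obtain ⟨x, y, hxy⟩ := exists_pair_lt M
  obtain ⟨p, -, -, hp⟩ := hmem x y hxy
  exact (dcl_mono (empty_subset _)).trans (hdcl p hp)

end TamePredicate

/-! ### Extending elementary relations that respect the predicates -/

section Extension

variable {L : FirstOrder.Language.{u, v}} {T : L.Theory} {M : Type w} [L.Structure M]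
  [LinearOrder M] [DenselyOrdered M] {P : Set M}

/-- If `a ∈ Q` and `a₀ ∈ dcl {a}`, closure of `Q` gives `a₀ ∈ Q`; if `a₀ ∉ dcl {a}`, exchange puts
`a` in `dcl ∅`. -/
theorem IsMonsterLovelyPair.mem_iff (hP : IsMonsterLovelyPair T P) (hM : TameOrder L M)
    (hdcl : ∀ A : Set M, A.Nonempty → dcl L A = ⋃ a ∈ A, dcl L {a}) {Q : Set M}
    (hQ : IsTamePredicate L Q) {a₀ a : M} (ha : a ∈ dcl L {a₀}) :
    a ∈ Q ↔ a₀ ∈ Q ∨ a ∈ dcl L (∅ : Set M) := by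
  refine ⟨fun h => ?_, fun h => h.elim (fun h => hQ.dcl_singleton_subset a₀ h ha)
    fun h => hQ.dcl_empty_subset h⟩
  by_cases ha₀ : a₀ ∈ dcl L {a}
  · exact Or.inl (hQ.dcl_singleton_subset a h ha₀)
  · exact Or.inr (hP.exchange hM hdcl ha ha₀)

theorem IsMonsterLovelyPair.exists_insert_of_isTamePredicate (hP : IsMonsterLovelyPair T P)
    (hM : TameOrder L M) (hdcl : ∀ A : Set M, A.Nonempty → dcl L A = ⋃ a ∈ A, dcl L {a})
    {Q Q' : Set M} (hQ : IsTamePredicate L Q) (hQ' : IsTamePredicate L Q') {R : Set (M × M)}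
    (hR : IsElementaryRel L R) (hRQ : ∀ p ∈ R, p.1 ∈ Q ↔ p.2 ∈ Q') (hcard : #R < #M) (a : M) :
    ∃ b, IsElementaryRel L (insert (a, b) R) ∧ (a ∈ Q ↔ b ∈ Q') := by
  obtain ⟨b, hb⟩ := hP.exists_insert hR hcard a
  by_cases ha : a ∈ dcl L (Prod.fst '' R)
  · refine ⟨b, hb, ?_⟩
    have h₀ : a ∈ dcl L (∅ : Set M) ↔ b ∈ dcl L (∅ : Set M) := by
      constructor
      · simpa using hb.mem_dcl (mem_insert _ _) (empty_subset _)
      · simpa using hb.swap.mem_dcl (a := b) (b := a) (mem_insert _ _) (empty_subset _)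
    -- Degeneracy speaks of non-empty sets only; over the empty relation both points are in `dcl ∅`,
    -- hence in the predicates.
    rcases R.eq_empty_or_nonempty with rfl | hne
    · rw [image_empty] at ha
      exact iff_of_true (hQ.dcl_empty_subset ha) (hQ'.dcl_empty_subset (h₀.1 ha))
    · rw [hdcl _ (hne.image _)] at ha
      obtain ⟨_, ⟨⟨a₀, b₀⟩, hab, rfl⟩, ha⟩ := mem_iUnion₂.1 ha
      have hb' : b ∈ dcl L {b₀} := by
        have := hb.mem_dcl (mem_insert _ _) (singleton_subset_iff.2 (mem_insert_of_mem _ hab))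
        rw [image_singleton, image_singleton] at this
        exact this ha
      rw [hP.mem_iff hM hdcl hQ ha, hP.mem_iff hM hdcl hQ' hb', hRQ _ hab, h₀]
  · have hb' : b ∉ dcl L (Prod.snd '' R) := by
      intro hb'
      have := hb.swap.mem_dcl (a := b) (b := a) (S := Prod.swap ⁻¹' R) (mem_insert _ _)
        (fun p hp => mem_insert_of_mem _ hp)
      rw [← image_swap_eq_preimage_swap, image_image, image_image] at this
      exact ha (this hb')
    have hleft : ∀ Y ∈ typeSets L R a, ∃ u, u < b ∧ ∀ z, u < z → z < b → z ∈ Y := fun Y hY =>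
      hP.exists_left hM hdcl (definable₁_typeSets hY) hb' (mem_typeSets hb hY)
    -- Each set of the transported type contains an interval ending at `b`; saturation over `b` and
    -- the range gives one `u` for all of them, so every point of `(u, b)` realizes the type.
    obtain ⟨u, hu⟩ := hP.exists_forall_mem (A := insert b (Prod.snd '' R))
      (mk_insert_le.trans_lt (add_lt_of_lt hP.aleph0_lt.le (mk_image_le.trans_lt hcard)
        (one_lt_aleph0.trans hP.aleph0_lt)))
      (F := (fun Y => {u | u ∈ Iio b ∧ ∀ z, u < z → z ∈ Iio b → z ∈ Y}) '' typeSets L R a)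
      (typeSets_nonempty.image _) (by
        rintro _ ⟨Y, hY, rfl⟩
        have hlt := hM.definable₂_lt (insert b (Prod.snd '' R))
        have hIio := hM.definable₁_Iio (mem_insert b (Prod.snd '' R))
        exact definable₁_pair <| definable₁_of <| definable_and (definable_mem hIio _) <|
          definable_all <| definable_imp (definable_rel hlt _ _) <|
          definable_imp (definable_mem hIio _) <|
          definable_mem ((definable₁_typeSets hY).mono (subset_insert _ _)) _) (by
        rintro _ ⟨Y, hY, rfl⟩ _ ⟨Z, hZ, rfl⟩
        exact ⟨_, ⟨_, typeSets_inter hY hZ, rfl⟩, fun u hu =>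
          ⟨⟨hu.1, fun z h h' => (hu.2 z h h').1⟩, hu.1, fun z h h' => (hu.2 z h h').2⟩⟩) (by
        rintro _ ⟨Y, hY, rfl⟩
        exact hleft Y hY)
    have hub : u < b := by
      obtain ⟨Y, hY⟩ := typeSets_nonempty (L := L) (R := R) (a := a)
      exact (hu _ ⟨Y, hY, rfl⟩).1
    have hc : ∀ c, u < c → c < b → IsElementaryRel L (insert (a, c) R) := fun c h h' =>
      isElementaryRel_insert fun Y hY => (hu _ ⟨Y, hY, rfl⟩).2 c h h'
    by_cases haQ : a ∈ Q
    · obtain ⟨c, huc, hcb, hcQ⟩ := hQ'.exists_mem u b hub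
      exact ⟨c, hc c huc hcb, iff_of_true haQ hcQ⟩
    · obtain ⟨c, huc, hcb, hcQ⟩ := hQ'.exists_notMem u b hub
      exact ⟨c, hc c huc hcb, iff_of_false haQ hcQ⟩

theorem IsMonsterLovelyPair.exists_isElementaryRel (hP : IsMonsterLovelyPair T P)
    (hM : TameOrder L M) (hdcl : ∀ A : Set M, A.Nonempty → dcl L A = ⋃ a ∈ A, dcl L {a})
    {Q Q' : Set M} (hQ : IsTamePredicate L Q) (hQ' : IsTamePredicate L Q') :
    ∃ R : Set (M × M), (IsElementaryRel L R ∧ ∀ p ∈ R, p.1 ∈ Q ↔ p.2 ∈ Q') ∧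
      (∀ a, ∃ b, (a, b) ∈ R) ∧ ∀ b, ∃ a, (a, b) ∈ R := by
  refine exists_total_rel hP.aleph0_lt.le
    (Good := fun R => IsElementaryRel L R ∧ ∀ p ∈ R, p.1 ∈ Q ↔ p.2 ∈ Q')
    ⟨isElementaryRel_empty, by simp⟩ ?_ ?_ ?_
  · refine fun F hne hdir h => ⟨isElementaryRel_sUnion hne hdir fun R hR => (h R hR).1, ?_⟩
    rintro p ⟨R, hR, hp⟩
    exact (h R hR).2 p hp
  · rintro R ⟨hR, hRQ⟩ hcard a
    obtain ⟨b, hb, hab⟩ := hP.exists_insert_of_isTamePredicate hM hdcl hQ hQ' hR hRQ hcard a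
    refine ⟨b, hb, ?_⟩
    rintro p (rfl | hp)
    exacts [hab, hRQ p hp]
  · rintro R ⟨hR, hRQ⟩ hcard b
    -- The back step is the forth step for the inverse relation, with the two predicates exchanged.
    obtain ⟨a, ha, hab⟩ := hP.exists_insert_of_isTamePredicate hM hdcl hQ' hQ hR.swap
      (fun p hp => (hRQ p.swap hp).symm)
      (by rwa [← image_swap_eq_preimage_swap, mk_image_eq Prod.swap_injective]) b
    refine ⟨a, ha.swap.mono ?_, ?_⟩
    · rintro p (rfl | hp)
      exacts [mem_insert _ _, mem_insert_of_mem _ hp]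
    · rintro p (rfl | hp)
      exacts [hab.symm, hRQ p hp]

end Extension

/-! ### From total elementary relations to automorphisms -/

section Automorphism

variable {L : FirstOrder.Language.{u, v}} {M : Type w} [L.Structure M]

theorem IsElementaryRel.realize_iff {R : Set (M × M)} (h : IsElementaryRel L R) {f : M → M}
    (hf : ∀ a, (a, f a) ∈ R) {n : ℕ} (φ : L.Formula (Fin n)) (x : Fin n → M) :
    φ.Realize (f ∘ x) ↔ φ.Realize x := (h.iff φ (fun i => (x i, f (x i))) fun _ => hf _).symm

/-- Preservation of the formula `x = y` in both directions makes `R` the graph of a bijection.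
Function symbols are handled through the formula `F x = y`, with the value as last entry of the
tuple. -/
theorem IsElementaryRel.exists_equiv {R : Set (M × M)} (h : IsElementaryRel L R)
    (hl : ∀ a, ∃ b, (a, b) ∈ R) (hr : ∀ b, ∃ a, (a, b) ∈ R) :
    ∃ σ : M ≃[L] M, ∀ a, (a, σ a) ∈ R := by
  have heq : ∀ a b a' b', (a, b) ∈ R → (a', b') ∈ R → (a = a' ↔ b = b') := by
    intro a b a' b' hab hab'
    have := h.iff (Term.equal (Term.var 0) (Term.var 1)) ![(a, b), (a', b')] (by
      intro k
      fin_cases k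
      exacts [hab, hab'])
    simpa using this
  choose f hf using hl
  choose g hg using hr
  let e : M ≃ M := ⟨f, g, fun a => (heq _ _ _ _ (hg (f a)) (hf a)).2 rfl,
    fun b => (heq _ _ _ _ (hf (g b)) (hg b)).1 rfl⟩
  refine ⟨⟨e, fun {n} F x => ?_, fun {n} r x => ?_⟩, hf⟩
  · have := h.realize_iff hf (Term.equal (Term.func F fun i => Term.var i.castSucc)
      (Term.var (Fin.last n))) (Fin.snoc (α := fun _ => M) x (Structure.funMap F x))
    change f _ = Structure.funMap F (f ∘ x)
    simpa [Function.comp_def, eq_comm] using this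
  · have := h.realize_iff hf (r.formula fun i => Term.var i) x
    change Structure.RelMap r (f ∘ x) ↔ _
    simpa [Formula.realize_rel, Function.comp_def] using this

theorem orbit_subset_elementaryClass (P : Set M) : orbit L P ⊆ elementaryClass L P := by
  rintro _ ⟨σ, rfl⟩
  let e : Pair P ≃[pairLanguage L] Pair (σ '' P) :=
    { toEquiv := σ.toEquiv
      map_fun' := by
        rintro n (f | f) x
        · exact σ.map_fun' f x
        · exact nomatch f
      map_rel' := by
        rintro n (r | r) x
        · exact σ.map_rel' r x
        · cases r
          exact σ.injective.mem_set_image }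
  exact StrongHomClass.elementarilyEquivalent e

end Automorphism

end LovelyPairs

theorem proposition5p7 {L : FirstOrder.Language.{u, v}} (T : L.Theory)
    (N : Type w') [L.Structure N] [LinearOrder N] [DenselyOrdered N]
    (hN : LovelyPairs.IsOMinimal L N) (hT : T = L.completeTheory N)
    (M : Type w) [L.Structure M] (P : Set M)
    (hP : LovelyPairs.IsMonsterLovelyPair T P)
    (hdcl : ∀ A : Set M, A.Nonempty →
      LovelyPairs.dcl L A = ⋃ a ∈ A, LovelyPairs.dcl L {a}) :
    LovelyPairs.orbit L P = LovelyPairs.elementaryClass L P := by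
  refine Set.Subset.antisymm (LovelyPairs.orbit_subset_elementaryClass P) fun P' hP' => ?_
  have hNM : L.ElementarilyEquivalent N M := by
    have := hP.isModel.model
    rw [hT] at this
    exact FirstOrder.Language.elementarilyEquivalent_iff.2 fun φ =>
      (FirstOrder.Language.realize_iff_of_model_completeTheory N M φ).symm
  obtain ⟨_, _, hM⟩ := hN.tameOrder.transfer hNM
  have : Infinite M := Cardinal.infinite_iff.2 hP.aleph0_lt.le
  have hQ := hP.isModel.isTamePredicate hM
  have hQ' := hQ.of_elementarilyEquivalent hM hP' hP.isModel.elementary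
  obtain ⟨R, ⟨hR, hRQ⟩, hl, hr⟩ := hP.exists_isElementaryRel hM hdcl hQ hQ'
  obtain ⟨σ, hσ⟩ := hR.exists_equiv hl hr
  refine ⟨σ, Set.ext fun b => ?_⟩
  rw [← σ.apply_symm_apply b, σ.injective.mem_set_image]
  exact hRQ _ (hσ _)
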